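/- Let $k$ be an algebraically closed field and let $\mathcal C$ be a $k$-linear abelian rigid monoidal category with $k$-bilinear tensor product and finite-dimensional Hom-spaces, which is semisimple (every object is a finite direct sum of simple objects), has finitely many isomorphism classes of simple objects, and has a simple unit object $\mathbf 1$. A module category over $\mathcal C$ is a $k$-linear abelian category $\mathcal M$ with a bifunctor $\otimes:\mathcal C\times\mathcal M\to\mathcal M$, $k$-bilinear on morphisms and exact in each variable, together with associativity and unit isomorphisms satisfying the pentagon and triangle axioms. Two module categories are equivalent if there is an equivalence of categories $F$ between them together with coherent natural isomorphisms $F(X\otimes M)\cong X\otimes F(M)$. A module category is indecomposable if it is not equivalent to a direct sum $\mathcal M_1\times\mathcal M_2$ of two nonzero module categories. For an (associative unital) algebra $A$ in $\mathcal C$, let $\mathrm{Mod}_{\mathcal C}(A)$ be the module category of right $A$-modules in $\mathcal C$, with $X\otimes M$ ($X\in\mathcal C$) carrying the $A$-action of $M$. The algebra $A$ is semisimple (indecomposable) if $\mathrm{Mod}_{\mathcal C}(A)$ is semisimple as a category (indecomposable as a module category); algebras $A$ and $B$ are Morita equivalent if the module categories $\mathrm{Mod}_{\mathcal C}(A)$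 and $\mathrm{Mod}_{\mathcal C}(B)$ are equivalent. Corollary. Every nonzero semisimple indecomposable algebra $A$ in $\mathcal C$ is Morita equivalent to an algebra $B$ in $\mathcal C$ with $\mathrm{Hom}(\mathbf 1,B)=k$, that is, such that $c\mapsto c\cdot e_B$ is a bijection $k\to\mathrm{Hom}(\mathbf 1,B)$, where $e_B:\mathbf 1\to B$ is the unit morphism of $B$. More precisely, $\mathrm{Mod}_{\mathcal C}(A)$ has a simple object, and for every simple object $M$ of $\mathrm{Mod}_{\mathcal C}(A)$ the internal endomorphism algebra $B=\underline{\mathrm{Hom}}(M,M)$ exists in $\mathcal C$ and has these properties. Here $\underline{\mathrm{Hom}}(M,M)$ is the object of $\mathcal C$ representing the functor $X\mapsto\mathrm{Hom}_A(X\otimes M,M)$, with multiplication and unit induced by the composite $(B\otimes B)\otimes M\cong B\otimes(B\otimes M)\to B\otimes M\to M$ of evaluation maps and by the isomorphism $\mathbf 1\otimes M\cong M$. -/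

import Mathlib

open CategoryTheory CategoryTheory.Limits CategoryTheory.MonoidalCategory
open scoped MonObj MonoidalLeftAction

universe w v u v₁ u₁ v₂ u₂

namespace TensorMorita

/-! ## Semisimplicity -/

/-- A category is semisimple if every object is a finite direct sum of simple objects. -/
def IsSemisimpleCategory (D : Type u) [Category.{v} D] [Preadditive D] : Prop :=
  ∀ X : D, ∃ (n : ℕ) (S : Fin n → D) (b : Bicone S),
    (∀ i, Simple (S i)) ∧ Nonempty b.IsBilimit ∧ Nonempty (X ≅ b.pt)

/-- A category has finitely many simple objects up to isomorphism. -/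
def HasFinitelyManySimples (D : Type u) [Category.{v} D] [Preadditive D] : Prop :=
  ∃ (n : ℕ) (S : Fin n → D), ∀ X : D, Simple X → ∃ i, Nonempty (X ≅ S i)

/-! ## Module categories -/

/-- Two categories with an action of `C` are equivalent if there is a functor between them that is
an equivalence of categories and that commutes with the action up to coherent natural
isomorphisms. -/
def ModuleEquivalent (C : Type u) [Category.{v} C] [MonoidalCategory C]
    (M : Type u₁) [Category.{v₁} M] [MonoidalLeftAction C M]
    (N : Type u₂) [Category.{v₂} N] [MonoidalLeftAction C N] : Prop :=
  ∃ F : M ⥤ N, F.IsEquivalence ∧ Nonempty (F.LeftLinear C)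

/-- A module category over a `k`-linear monoidal category `C`: a `k`-linear abelian category
with a `k`-bilinear action of `C` which is exact in each variable. -/
structure ModuleCategory (k : Type w) [Field k] (C : Type u) [Category.{v} C]
    [Preadditive C] [Linear k C] [MonoidalCategory C] where
  /-- The objects. -/
  carrier : Type u₁
  [category : Category.{v₁} carrier]
  [abelian : Abelian carrier]
  [linear : Linear k carrier]
  [action : MonoidalLeftAction C carrier]
  additive_right : ∀ X : C,
    ((MonoidalLeftAction.curriedAction C carrier).obj X).Additive
  linear_right : ∀ X : C,
    ((MonoidalLeftAction.curriedAction C carrier).obj X).Linear k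
  exact_right : ∀ X : C,
    PreservesFiniteLimits ((MonoidalLeftAction.curriedAction C carrier).obj X) ∧
    PreservesFiniteColimits ((MonoidalLeftAction.curriedAction C carrier).obj X)
  additive_left : ∀ N : carrier,
    ((MonoidalLeftAction.curriedAction C carrier).flip.obj N).Additive
  linear_left : ∀ N : carrier,
    ((MonoidalLeftAction.curriedAction C carrier).flip.obj N).Linear k
  exact_left : ∀ N : carrier,
    PreservesFiniteLimits ((MonoidalLeftAction.curriedAction C carrier).flip.obj N) ∧
    PreservesFiniteColimits ((MonoidalLeftAction.curriedAction C carrier).flip.obj N)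

attribute [instance] ModuleCategory.category ModuleCategory.abelian ModuleCategory.linear
  ModuleCategory.action

/-- A module category is nontrivial if it has a nonzero object. -/
def ModuleCategory.IsNontrivial {k : Type w} [Field k] {C : Type u} [Category.{v} C]
    [Preadditive C] [Linear k C] [MonoidalCategory C]
    (M : ModuleCategory.{w, v, u, v₁, u₁} k C) : Prop :=
  ∃ X : M.carrier, ¬ IsZero X

/-- The coordinatewise action of `C` on a product of two categories. -/
instance prodAction (C : Type u) [Category.{v} C] [MonoidalCategory C]
    (M : Type u₁) [Category.{v₁} M] [MonoidalLeftAction C M]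
    (N : Type u₂) [Category.{v₂} N] [MonoidalLeftAction C N] :
    MonoidalLeftAction C (M × N) where
  actionObj X P := (X ⊙ₗ P.1, X ⊙ₗ P.2)
  actionHomLeft f P := (f ⊵ₗ P.1, f ⊵ₗ P.2)
  actionHomRight X _ _ g := (X ⊴ₗ g.1, X ⊴ₗ g.2)
  actionHom f g := (f ⊙ₗₘ g.1, f ⊙ₗₘ g.2)
  actionAssocIso X Y P := Iso.prod (αₗ X Y P.1) (αₗ X Y P.2)
  actionUnitIso P := Iso.prod (λₗ P.1) (λₗ P.2)
  actionHom_def f g := by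
    ext
    · exact MonoidalLeftAction.actionHom_def f g.1
    · exact MonoidalLeftAction.actionHom_def f g.2
  actionAssocIso_hom_naturality f g h := by
    ext
    · exact MonoidalLeftAction.actionAssocIso_hom_naturality f g h.1
    · exact MonoidalLeftAction.actionAssocIso_hom_naturality f g h.2
  actionUnitIso_hom_naturality f := by
    ext
    · exact MonoidalLeftAction.actionUnitIso_hom_naturality f.1
    · exact MonoidalLeftAction.actionUnitIso_hom_naturality f.2

/-- A category `M` with an action of `C` is indecomposable if it is not equivalent to the direct
sum of two nontrivial module categories. (Summands of `M` are equivalent to full subcategories of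
`M`, so the universe levels of `M` suffice for them.) -/
def IsIndecomposable (k : Type w) [Field k] (C : Type u) [Category.{v} C]
    [Preadditive C] [Linear k C] [MonoidalCategory C]
    (M : Type u₁) [Category.{v₁} M] [MonoidalLeftAction C M] : Prop :=
  ¬ ∃ M₁ M₂ : ModuleCategory.{w, v, u, v₁, u₁} k C,
    M₁.IsNontrivial ∧ M₂.IsNontrivial ∧
      ModuleEquivalent C M (M₁.carrier × M₂.carrier)

/-! ## Right modules over an algebra -/

section RightMod

variable {C : Type u} [Category.{v} C] [MonoidalCategory C]

/-- A right module over an algebra `A` in `C`. -/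
structure RightMod (A : C) [MonObj A] where
  /-- The underlying object. -/
  X : C
  /-- The action morphism. -/
  act : X ⊗ A ⟶ X
  act_one : X ◁ η[A] ≫ act = (ρ_ X).hom
  act_mul : act ▷ A ≫ act = (α_ X A A).hom ≫ X ◁ μ[A] ≫ act

namespace RightMod

attribute [simp] act_one act_mul

variable {A : C} [MonObj A]

/-- A morphism of right modules. -/
@[ext]
structure Hom (M N : RightMod A) where
  /-- The underlying morphism. -/
  hom : M.X ⟶ N.X
  comm : M.act ≫ hom = hom ▷ A ≫ N.act

/-- The category of right modules over `A`. -/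
instance : Category (RightMod A) where
  Hom M N := Hom M N
  id M := { hom := 𝟙 M.X, comm := by simp }
  comp f g := { hom := f.hom ≫ g.hom
                comm := by
                  rw [← Category.assoc, f.comm, Category.assoc, g.comm]
                  simp }

@[ext]
theorem hom_ext {M N : RightMod A} {f g : M ⟶ N} (h : f.hom = g.hom) : f = g := Hom.ext h

@[simp] theorem id_hom (M : RightMod A) : Hom.hom (𝟙 M) = 𝟙 M.X := rfl

@[simp] theorem comp_hom {M N P : RightMod A} (f : M ⟶ N) (g : N ⟶ P) :
    Hom.hom (f ≫ g) = f.hom ≫ g.hom := rfl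

/-- An isomorphism of underlying objects compatible with the actions. -/
@[simps]
def mkIso {M N : RightMod A} (e : M.X ≅ N.X) (h : M.act ≫ e.hom = e.hom ▷ A ≫ N.act) :
    M ≅ N where
  hom := { hom := e.hom, comm := h }
  inv := { hom := e.inv
           comm := by
             rw [Iso.comp_inv_eq, Category.assoc, h, ← comp_whiskerRight_assoc]
             simp }

section Preadditive

variable [Preadditive C] [MonoidalPreadditive C]

instance (M N : RightMod A) : Zero (M ⟶ N) := ⟨{ hom := 0, comm := by simp }⟩

instance (M N : RightMod A) : Add (M ⟶ N) :=
  ⟨fun f g => { hom := f.hom + g.hom, comm := by simp [f.comm, g.comm] }⟩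

instance (M N : RightMod A) : Neg (M ⟶ N) :=
  ⟨fun f => { hom := - f.hom
              comm := by
                have h : (-f.hom) ▷ A = - (f.hom ▷ A) :=
                  (tensorRight A).map_neg (f := f.hom)
                rw [h]
                simp [f.comm] }⟩

@[simp] theorem zero_hom (M N : RightMod A) : Hom.hom (0 : M ⟶ N) = 0 := rfl

@[simp] theorem add_hom {M N : RightMod A} (f g : M ⟶ N) :
    Hom.hom (f + g) = f.hom + g.hom := rfl

@[simp] theorem neg_hom {M N : RightMod A} (f : M ⟶ N) : Hom.hom (-f) = - f.hom := rfl

/-- Morphisms of right modules are added as morphisms of `C`. -/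
instance : Preadditive (RightMod A) where
  homGroup M N :=
    { add_assoc := fun f g h => by ext; simp [add_assoc]
      zero_add := fun f => by ext; simp
      add_zero := fun f => by ext; simp
      nsmul := nsmulRec
      zsmul := zsmulRec
      neg_add_cancel := fun f => by ext; simp
      add_comm := fun f g => by ext; simp [add_comm] }

end Preadditive

/-- The right module `X ⊗ M`, with `A` acting on `M`. -/
@[simps]
def tensor (X : C) (M : RightMod A) : RightMod A where
  X := X ⊗ M.X
  act := (α_ X M.X A).hom ≫ X ◁ M.act
  act_one := by
    rw [associator_naturality_right_assoc, ← whiskerLeft_comp, act_one]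
    simp
  act_mul := by
    simp only [comp_whiskerRight, Category.assoc, associator_naturality_middle_assoc,
      associator_naturality_right_assoc, ← whiskerLeft_comp, act_mul]
    simp

/-- The action `(X, M) ↦ X ⊗ M` of `C` on right modules, whose associativity and unit isomorphisms
are those of `C`. -/
instance : MonoidalLeftAction C (RightMod A) where
  actionObj X M := tensor X M
  actionHomLeft {X Y} f M :=
    { hom := f ▷ M.X
      comm := by
        change ((α_ X M.X A).hom ≫ X ◁ M.act) ≫ f ▷ M.X =
          f ▷ M.X ▷ A ≫ (α_ Y M.X A).hom ≫ Y ◁ M.act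
        simp [whisker_exchange] }
  actionHomRight X M N g :=
    { hom := X ◁ g.hom
      comm := by
        change ((α_ X M.X A).hom ≫ X ◁ M.act) ≫ X ◁ g.hom =
          (X ◁ g.hom) ▷ A ≫ (α_ X N.X A).hom ≫ X ◁ N.act
        simp [← MonoidalCategory.whiskerLeft_comp, g.comm] }
  actionAssocIso X Y M := mkIso (α_ X Y M.X) (by
    change ((α_ (X ⊗ Y) M.X A).hom ≫ (X ⊗ Y) ◁ M.act) ≫ (α_ X Y M.X).hom =
      (α_ X Y M.X).hom ▷ A ≫ (α_ X (Y ⊗ M.X) A).hom ≫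
        X ◁ ((α_ Y M.X A).hom ≫ Y ◁ M.act)
    simp)
  actionUnitIso M := mkIso (λ_ M.X) (by
    change ((α_ (𝟙_ C) M.X A).hom ≫ 𝟙_ C ◁ M.act) ≫ (λ_ M.X).hom =
      (λ_ M.X).hom ▷ A ≫ M.act
    simp)
  actionHomRight_id X M := hom_ext (MonoidalCategory.whiskerLeft_id X M.X)
  id_actionHomLeft X M := hom_ext (MonoidalCategory.id_whiskerRight X M.X)
  actionHom_comp {X Y Z} {M N P} f₁ f₂ g₁ g₂ := hom_ext <| by
    change (f₁ ≫ f₂) ▷ M.X ≫ Z ◁ (g₁.hom ≫ g₂.hom) =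
      (f₁ ▷ M.X ≫ Y ◁ g₁.hom) ≫ f₂ ▷ N.X ≫ Z ◁ g₂.hom
    simp [whisker_exchange_assoc]
  actionAssocIso_hom_naturality {X₁ X₂ Y₁ Y₂} {M N} f g h := hom_ext <| by
    change ((f ⊗ₘ g) ▷ M.X ≫ (X₂ ⊗ Y₂) ◁ h.hom) ≫ (α_ X₂ Y₂ N.X).hom =
      (α_ X₁ Y₁ M.X).hom ≫ f ▷ (Y₁ ⊗ M.X) ≫ X₂ ◁ (g ▷ M.X ≫ Y₂ ◁ h.hom)
    simp [MonoidalCategory.tensorHom_def]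
  actionUnitIso_hom_naturality {M N} f := hom_ext <| by
    change (λ_ M.X).hom ≫ f.hom = 𝟙_ C ◁ f.hom ≫ (λ_ N.X).hom
    simp
  whiskerLeft_actionHomLeft X {Y Z} f M := hom_ext <| by
    change (X ◁ f) ▷ M.X = (α_ X Y M.X).hom ≫ X ◁ f ▷ M.X ≫ (α_ X Z M.X).inv
    simp
  whiskerRight_actionHomLeft {X Y} Z f M := hom_ext <| by
    change (f ▷ Z) ▷ M.X = (α_ X Z M.X).hom ≫ f ▷ (Z ⊗ M.X) ≫ (α_ Y Z M.X).inv
    simp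
  associator_actionHom X Y Z M := hom_ext (MonoidalCategory.pentagon X Y Z M.X)
  leftUnitor_actionHom X M := hom_ext (MonoidalCategory.leftUnitor_whiskerRight X M.X)
  rightUnitor_actionHom X M := hom_ext (MonoidalCategory.triangle X M.X).symm

end RightMod

end RightMod

/-! ## Properties of algebras -/

/-- An algebra is semisimple if its category of right modules is. -/
def IsSemisimpleAlgebra {C : Type u} [Category.{v} C] [Preadditive C] [MonoidalCategory C]
    [MonoidalPreadditive C] (A : C) [MonObj A] : Prop :=
  IsSemisimpleCategory (RightMod A)

/-- An algebra is indecomposable if its module category of right modules is. -/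
def IsIndecomposableAlgebra (k : Type w) [Field k] {C : Type u} [Category.{v} C]
    [Preadditive C] [Linear k C] [MonoidalCategory C] (A : C) [MonObj A] : Prop :=
  IsIndecomposable k C (RightMod A)

/-- Two algebras are Morita equivalent if their module categories of right modules are
equivalent as module categories. -/
def MoritaEquivalent {C : Type u} [Category.{v} C] [MonoidalCategory C]
    (A B : C) [MonObj A] [MonObj B] : Prop :=
  ModuleEquivalent C (RightMod A) (RightMod B)

/-! ## Internal Hom -/

section InternalHom

variable {C : Type u} [Category.{v} C] [MonoidalCategory C]
  {M : Type u₁} [Category.{v₁} M] [MonoidalLeftAction C M]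

/-- `H`, with evaluation `ev`, is an internal Hom from `M₁` to `M₂`: it represents the functor
`X ↦ Hom(X ⊗ M₁, M₂)`, with universal element `ev`. -/
def IsInternalHom (M₁ M₂ : M) (H : C) (ev : H ⊙ₗ M₁ ⟶ M₂) : Prop :=
  ∀ X : C, Function.Bijective (fun f : X ⟶ H => (f ⊵ₗ M₁ ≫ ev : X ⊙ₗ M₁ ⟶ M₂))

/-- The algebra `B` is the internal endomorphism algebra of `N`: as an object it is the
internal Hom from `N` to `N`, its multiplication is the composition
`(B ⊗ B) ⊗ N ≅ B ⊗ (B ⊗ N) ⟶ B ⊗ N ⟶ N`, and its unit corresponds to `1 ⊗ N ≅ N`. -/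
def IsInternalEnd (N : M) (B : C) [MonObj B] : Prop :=
  ∃ ev : B ⊙ₗ N ⟶ N, IsInternalHom N N B ev ∧
    μ[B] ⊵ₗ N ≫ ev = (αₗ B B N).hom ≫ B ⊴ₗ ev ≫ ev ∧
    η[B] ⊵ₗ N ≫ ev = (λₗ N).hom

end InternalHom

end TensorMorita

namespace TensorMorita

/-! ## Semisimple categories -/

/-! Fix a simple `A`-module `M`. The equivalence is the functor sending `N` to the internal Hom from
`M` to `N`, a right module over the internal endomorphism algebra `B` of `M`. The internal Hom
exists because `N ⊗ Mᵛ` represents `X ↦ Hom(X ⊗ M, N)` in `C`, and `A`-linearity cuts out an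
equalizer inside it (`RightMod.exists_isInternalHom`). Duals in `C` also make the functor commute
with the action (`InternalHoms.isIso_tensorComparison`).

The objects `X ⊗ M` go to the free modules `X ⊗ B`, and `Hom_B(X ⊗ B, Hom(M, N)) = Hom_C(X, Hom(M,
N)) = Hom_A(X ⊗ M, N)`. The functor is therefore fully faithful as soon as every object is a retract
of some `X ⊗ M`. Indecomposability provides this (`exists_retract_action`): a simple object either
receives no nonzero map from any `X ⊗ M` or is a retract of one. The two kinds generate mutually
orthogonal summands, stable under the action by rigidity. The second summand contains `M`, so the
first vanishes.

For essential surjectivity, a `B`-module `P` has the free presentation `P ⊗ B ⊗ B ⇉ P ⊗ B → P`. Maps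
between free modules come from the semisimple source category, so the presentation splits, `P` is a
retract of `P ⊗ B`, and the idempotent lifts and splits. Finally `Hom(1, B) = End_A(M) = k` by
Schur's lemma.

Semisimplicity is used in the form that every morphism `f` has some `s` with `f ≫ s ≫ f = f`. This
property passes to full subcategories, and with split idempotents and finite products it yields an
abelian category on which additive functors are exact. The summands excluded by indecomposability
must be shown to be such categories. -/

section Regular

variable {D : Type u} [Category.{v} D]

/-- A morphism is von Neumann regular if it has a pseudo-inverse. -/
def IsRegularHom {X Y : D} (f : X ⟶ Y) : Prop := ∃ s : Y ⟶ X, f ≫ s ≫ f = f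

variable [Preadditive D]

/-- McCoy's trick: with `b` a pseudo-inverse of `f - f ≫ a ≫ f`, the correction added to `a`
contributes exactly that difference to `f ≫ s ≫ f`. -/
theorem IsRegularHom.of_sub {X Y : D} {f : X ⟶ Y} (a : Y ⟶ X)
    (h : IsRegularHom (f - f ≫ a ≫ f)) : IsRegularHom f := by
  obtain ⟨b, hb⟩ := h
  refine ⟨a + (𝟙 Y - a ≫ f) ≫ b ≫ (𝟙 X - f ≫ a), ?_⟩
  simp only [Preadditive.comp_add, Preadditive.add_comp, Preadditive.sub_comp,
    Preadditive.comp_sub, Category.assoc, Category.id_comp, Category.comp_id] at hb ⊢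
  rw [← sub_eq_zero] at hb ⊢
  rw [← hb]
  abel

/-- Some component of `f` into a simple summand of `Y` is nonzero, hence invertible by Schur's
lemma. -/
theorem exists_retraction_of_simple [HasKernels D] {S Y : D} [Simple S]
    (hY : ∃ (n : ℕ) (S : Fin n → D) (b : Bicone S),
      (∀ i, Simple (S i)) ∧ Nonempty b.IsBilimit ∧ Nonempty (Y ≅ b.pt))
    (f : S ⟶ Y) (hf : f ≠ 0) : ∃ r : Y ⟶ S, f ≫ r = 𝟙 S := by
  obtain ⟨n, T, b, hT, ⟨hb⟩, ⟨e⟩⟩ := hY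
  have : ∃ j, f ≫ e.hom ≫ b.π j ≠ 0 := by
    by_contra! h
    apply hf
    rw [← cancel_mono e.hom, zero_comp]
    apply hb.isLimit.hom_ext
    rintro ⟨j⟩
    simpa using h j
  obtain ⟨j, hj⟩ := this
  have := hT j
  have := isIso_of_hom_simple hj
  refine ⟨e.hom ≫ b.π j ≫ inv (f ≫ e.hom ≫ b.π j), ?_⟩
  have := IsIso.hom_inv_id (f ≫ e.hom ≫ b.π j)
  simpa only [Category.assoc] using this

theorem isRegularHom_of_semisimple [HasKernels D] (hD : IsSemisimpleCategory D) {X Y : D}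
    (f : X ⟶ Y) : IsRegularHom f := by
  classical
  obtain ⟨n, S, b, hS, ⟨hb⟩, ⟨e⟩⟩ := hD X
  -- Induction on a set `J` of simple summands of `X` outside which `g` vanishes.
  have key : ∀ (J : Finset (Fin n)) (g : X ⟶ Y),
      (∀ i, i ∉ J → b.ι i ≫ e.inv ≫ g = 0) → IsRegularHom g := by
    intro J
    induction J using Finset.induction_on with
    | empty =>
      intro g hg
      refine ⟨0, ?_⟩
      have : g = 0 := by
        rw [← cancel_epi e.inv, comp_zero]
        apply hb.isColimit.hom_ext
        rintro ⟨j⟩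
        simpa using hg j (by simp)
      simp [this]
    | insert i J hi ih =>
      intro g hg
      by_cases h0 : b.ι i ≫ e.inv ≫ g = 0
      · refine ih g fun l hl => ?_
        by_cases hli : l = i
        · rw [hli, h0]
        · exact hg l (by simp [hl, hli])
      · have := hS i
        obtain ⟨r, hr⟩ := exists_retraction_of_simple (hD Y) _ h0
        -- Subtracting `g ≫ a ≫ g`, with `a` built from the retraction `r`, kills `g` on summand `i`
        -- and keeps the zeros outside `J`.
        refine IsRegularHom.of_sub (r ≫ b.ι i ≫ e.inv) (ih _ fun l hl => ?_)
        by_cases hli : l = i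
        · subst hli
          simp only [Category.assoc] at hr
          simp only [Preadditive.comp_sub, Category.assoc, reassoc_of% hr, sub_self]
        · have := hg l (by simp [hl, hli])
          simp only [Preadditive.comp_sub, Category.assoc, reassoc_of% this, this, zero_comp,
            sub_self]
  exact key Finset.univ f (by simp)

/-- `s ≫ f` is idempotent, and the cokernel is the image of the complementary idempotent `𝟙 Y - s ≫
f`. Kernels below are dual. -/
theorem exists_cokernel_of_isRegularHom [IsIdempotentComplete D] {X Y : D} (f : X ⟶ Y)
    (hf : IsRegularHom f) : HasCokernel f := by
  obtain ⟨s, hs⟩ := hf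
  have hid : (s ≫ f) ≫ s ≫ f = s ≫ f := by simp [hs]
  obtain ⟨Q, i, p, hip, hpi⟩ := IsIdempotentComplete.idempotents_split Y (𝟙 Y - s ≫ f)
    (Idempotents.idem_of_id_sub_idem _ hid)
  have : Mono i := mono_of_mono_fac hip
  have : Epi p := epi_of_epi_fac hip
  have w : f ≫ p = 0 := by
    rw [← cancel_mono i, Category.assoc, hpi]
    simp [hs]
  refine ⟨⟨⟨CokernelCofork.ofπ p w, CokernelCofork.IsColimit.ofπ' p w fun {Z} g hg =>
    ⟨i ≫ g, ?_⟩⟩⟩⟩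
  rw [← Category.assoc, hpi]
  simp [hg]

theorem exists_kernel_of_isRegularHom [IsIdempotentComplete D] {X Y : D} (f : X ⟶ Y)
    (hf : IsRegularHom f) : HasKernel f := by
  obtain ⟨s, hs⟩ := hf
  have hid : (f ≫ s) ≫ f ≫ s = f ≫ s := by simp [reassoc_of% hs]
  obtain ⟨Q, i, p, hip, hpi⟩ := IsIdempotentComplete.idempotents_split X (𝟙 X - f ≫ s)
    (Idempotents.idem_of_id_sub_idem _ hid)
  have : Epi p := epi_of_epi_fac hip
  have : Mono i := mono_of_mono_fac hip
  have w : i ≫ f = 0 := by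
    rw [← cancel_epi p, ← Category.assoc, hpi]
    simp [hs]
  refine ⟨⟨⟨KernelFork.ofι i w, KernelFork.IsLimit.ofι' i w fun {Z} g hg =>
    ⟨g ≫ p, ?_⟩⟩⟩⟩
  rw [Category.assoc, hpi]
  simp [reassoc_of% hg]

/-- A Karoubian additive category all of whose morphisms are von Neumann regular is abelian. -/
@[reducible]
noncomputable def abelianOfRegular [IsIdempotentComplete D] [HasFiniteProducts D]
    (hD : ∀ {X Y : D} (f : X ⟶ Y), IsRegularHom f) : Abelian D where
  has_kernels := ⟨fun f => exists_kernel_of_isRegularHom f (hD f)⟩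
  has_cokernels := ⟨fun f => exists_cokernel_of_isRegularHom f (hD f)⟩
  normalMonoOfMono := fun {X Y} f _ => by
    obtain ⟨s, hs⟩ := hD f
    have h1 : f ≫ s = 𝟙 X := by rw [← cancel_mono f]; simp [hs]
    exact ⟨⟨Y, 𝟙 Y - s ≫ f, by simp [hs], KernelFork.IsLimit.ofι' _ _ fun {Z} g hg =>
      ⟨g ≫ s, by
        rw [Preadditive.comp_sub, sub_eq_zero, Category.comp_id] at hg
        rw [Category.assoc, ← hg]⟩⟩⟩
  normalEpiOfEpi := fun {X Y} f _ => by
    obtain ⟨s, hs⟩ := hD f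
    have h1 : s ≫ f = 𝟙 Y := by rw [← cancel_epi f, hs]; simp
    exact ⟨⟨X, 𝟙 X - f ≫ s, by simp [hs], CokernelCofork.IsColimit.ofπ' _ _ fun {Z} g hg =>
      ⟨s ≫ g, by
        rw [Preadditive.sub_comp, sub_eq_zero, Category.id_comp] at hg
        rw [← Category.assoc, ← hg]⟩⟩⟩

end Regular

/-! ### Exactness of additive functors -/

section Exact

variable {D : Type u} [Category.{v} D] [Abelian D] {E : Type u₁} [Category.{v₁} E] [Abelian E]

/-- An additive functor on an abelian category in which all morphisms are von Neumann regular
is exact. -/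
theorem exact_of_regular (hD : ∀ {X Y : D} (f : X ⟶ Y), IsRegularHom f) (F : D ⥤ E)
    [F.Additive] : PreservesFiniteLimits F ∧ PreservesFiniteColimits F := by
  have h : ∀ S : ShortComplex D, S.ShortExact → (S.map F).ShortExact := by
    intro S hS
    have := hS.mono_f
    obtain ⟨s, hs⟩ := hD S.f
    -- A regular monomorphism splits, so the sequence splits and any additive functor preserves it.
    have h1 : S.f ≫ s = 𝟙 _ := by rw [← cancel_mono S.f]; simp [hs]
    have : Epi S.g := hS.epi_g
    exact ((ShortComplex.Splitting.ofExactOfRetraction S hS.exact s h1 ‹_›).map F).shortExact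
  exact (F.exact_tfae.out 0 3 :).1 h

end Exact

/-! ## The category of right modules -/

namespace RightMod

variable {C : Type u} [Category.{v} C] [MonoidalCategory C] {A : C} [MonObj A]

theorem isIso_of_isIso_hom {M N : RightMod A} (f : M ⟶ N) [IsIso f.hom] : IsIso f :=
  (mkIso (asIso f.hom) f.comm).isIso_hom

/-- The algebra as a right module over itself. -/
@[simps]
def regular (A : C) [MonObj A] : RightMod A where
  X := A
  act := μ[A]
  act_one := by simp
  act_mul := by simp

variable [Preadditive C] [MonoidalPreadditive C]

/-- The action on the kernel of a morphism of right modules. -/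
noncomputable def kerAct [HasKernels C] {M N : RightMod A} (f : M ⟶ N) :
    kernel f.hom ⊗ A ⟶ kernel f.hom :=
  kernel.lift f.hom (kernel.ι f.hom ▷ A ≫ M.act) (by
    rw [Category.assoc, f.comm, ← comp_whiskerRight_assoc]
    simp)

@[simp]
theorem kerAct_ι [HasKernels C] {M N : RightMod A} (f : M ⟶ N) :
    kerAct f ≫ kernel.ι f.hom = kernel.ι f.hom ▷ A ≫ M.act := kernel.lift_ι _ _ _

theorem lift_kerAct [HasKernels C] {M N Z : RightMod A} (f : M ⟶ N) (g : Z ⟶ M)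
    (h : g.hom ≫ f.hom = 0) :
    Z.act ≫ kernel.lift f.hom g.hom h = kernel.lift f.hom g.hom h ▷ A ≫ kerAct f := by
  rw [← cancel_mono (kernel.ι f.hom), Category.assoc, kernel.lift_ι, Category.assoc, kerAct_ι,
    ← comp_whiskerRight_assoc, kernel.lift_ι, g.comm]

/-- The kernel of a morphism of right modules. -/
noncomputable def ker [HasKernels C] {M N : RightMod A} (f : M ⟶ N) : RightMod A where
  X := kernel f.hom
  act := kerAct f
  act_one := by
    rw [← cancel_mono (kernel.ι f.hom)]
    simp [whisker_exchange_assoc]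
  act_mul := by
    rw [← cancel_mono (kernel.ι f.hom)]
    simp only [Category.assoc, kerAct_ι, whisker_exchange_assoc, ← comp_whiskerRight_assoc]
    simp

instance [HasKernels C] : HasKernels (RightMod A) where
  has_limit {M N} f := by
    let i : ker f ⟶ M := { hom := kernel.ι f.hom, comm := kerAct_ι f }
    have hi : i ≫ f = 0 := by ext; exact kernel.condition f.hom
    have : Mono i := ⟨fun g h e => by
      ext
      exact (cancel_mono (kernel.ι f.hom)).1 (congrArg Hom.hom e)⟩
    refine ⟨⟨⟨KernelFork.ofι i hi, KernelFork.IsLimit.ofι' i hi fun {Z} g hg =>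
      ⟨{ hom := kernel.lift f.hom g.hom (congrArg Hom.hom hg), comm := ?_ }, ?_⟩⟩⟩⟩
    · exact lift_kerAct f g _
    · ext
      exact kernel.lift_ι _ _ _

instance [HasKernels C] : IsIdempotentComplete (RightMod A) :=
  (Idempotents.isIdempotentComplete_iff_idempotents_have_kernels _).2 fun _ _ _ => inferInstance

instance [HasZeroObject C] : HasZeroObject (RightMod A) := by
  let Z : RightMod A :=
    { X := HasZeroObject.zero' C |>.zero
      act := 0
      act_one := (isZero_zero C).eq_of_tgt _ _
      act_mul := (isZero_zero C).eq_of_tgt _ _ }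
  refine ⟨⟨Z, ?_⟩⟩
  · rw [IsZero.iff_id_eq_zero]
    ext
    exact (isZero_zero C).eq_of_tgt _ _

/-- The action on the direct sum of two right modules. -/
noncomputable def biprodAct [HasBinaryBiproducts C] (M N : RightMod A) :
    (M.X ⊞ N.X) ⊗ A ⟶ M.X ⊞ N.X :=
  biprod.lift (biprod.fst ▷ A ≫ M.act) (biprod.snd ▷ A ≫ N.act)

@[simp]
theorem biprodAct_fst [HasBinaryBiproducts C] (M N : RightMod A) :
    biprodAct M N ≫ biprod.fst = biprod.fst ▷ A ≫ M.act := biprod.lift_fst _ _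

@[simp]
theorem biprodAct_snd [HasBinaryBiproducts C] (M N : RightMod A) :
    biprodAct M N ≫ biprod.snd = biprod.snd ▷ A ≫ N.act := biprod.lift_snd _ _

theorem inl_biprodAct [HasBinaryBiproducts C] (M N : RightMod A) :
    M.act ≫ biprod.inl = biprod.inl ▷ A ≫ biprodAct M N := by
  apply biprod.hom_ext <;> simp [← comp_whiskerRight_assoc]

theorem inr_biprodAct [HasBinaryBiproducts C] (M N : RightMod A) :
    N.act ≫ biprod.inr = biprod.inr ▷ A ≫ biprodAct M N := by
  apply biprod.hom_ext <;> simp [← comp_whiskerRight_assoc]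

/-- The direct sum of two right modules. -/
noncomputable def biprod [HasBinaryBiproducts C] (M N : RightMod A) : RightMod A where
  X := M.X ⊞ N.X
  act := biprodAct M N
  act_one := by
    apply biprod.hom_ext <;> simp [whisker_exchange_assoc]
  act_mul := by
    apply biprod.hom_ext <;>
    simp only [Category.assoc, biprodAct_fst, biprodAct_snd, ← comp_whiskerRight_assoc,
      whisker_exchange_assoc] <;>
    simp

instance [HasBinaryBiproducts C] : HasBinaryBiproducts (RightMod A) where
  has_binary_biproduct M N := by
    let b : BinaryBicone M N :=
      { pt := biprod M N
        fst := { hom := biprod.fst, comm := biprodAct_fst M N }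
        snd := { hom := biprod.snd, comm := biprodAct_snd M N }
        inl := { hom := biprod.inl, comm := inl_biprodAct M N }
        inr := { hom := biprod.inr, comm := inr_biprodAct M N }
        inl_fst := hom_ext biprod.inl_fst
        inl_snd := hom_ext biprod.inl_snd
        inr_fst := hom_ext biprod.inr_fst
        inr_snd := hom_ext biprod.inr_snd }
    exact hasBinaryBiproduct_of_total b (hom_ext biprod.total)

instance [HasZeroObject C] [HasBinaryBiproducts C] : HasFiniteProducts (RightMod A) :=
  hasFiniteProducts_of_has_binary_and_terminal

section Linear

variable {k : Type w} [Field k] [Linear k C] [MonoidalLinear k C]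

instance (M N : RightMod A) : SMul k (M ⟶ N) :=
  ⟨fun c f => { hom := c • f.hom, comm := by simp [f.comm] }⟩

@[simp] theorem smul_hom {M N : RightMod A} (c : k) (f : M ⟶ N) :
    Hom.hom (c • f) = c • f.hom := rfl

/-- Morphisms of right modules are scaled as morphisms of `C`. -/
instance : Linear k (RightMod A) where
  homModule M N :=
    { one_smul := fun f => by ext; simp
      mul_smul := fun c d f => by ext; simp [mul_smul]
      smul_zero := fun c => by ext; simp
      smul_add := fun c f g => by ext; simp
      add_smul := fun c d f => by ext; simp [add_smul]
      zero_smul := fun f => by ext; simp }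

theorem finiteDimensional_hom (M N : RightMod A) [FiniteDimensional k (M.X ⟶ N.X)] :
    FiniteDimensional k (M ⟶ N) :=
  FiniteDimensional.of_injective
    ({ toFun := Hom.hom, map_add' := fun _ _ => rfl, map_smul' := fun _ _ => rfl } :
      (M ⟶ N) →ₗ[k] (M.X ⟶ N.X)) fun _ _ h => hom_ext h

end Linear

end RightMod

/-! ## Duality and actions -/

section Duality

open MonoidalLeftAction

variable {C : Type u} [Category.{v} C] [MonoidalCategory C]
  {D : Type u₁} [Category.{v₁} D] [MonoidalLeftAction C D]

theorem associator_inv_actionHom (X Y Z : C) (N : D) :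
    (α_ X Y Z).inv ⊵ₗ N = (αₗ X (Y ⊗ Z) N).hom ≫ X ⊴ₗ (αₗ Y Z N).hom ≫
      (αₗ X Y (Z ⊙ₗ N)).inv ≫ (αₗ (X ⊗ Y) Z N).inv := by
  rw [← cancel_epi ((α_ X Y Z).hom ⊵ₗ N), associator_actionHom_assoc]
  simp

theorem leftUnitor_inv_actionHom (X : C) (N : D) :
    (λ_ X).inv ⊵ₗ N = (λₗ (X ⊙ₗ N)).inv ≫ (αₗ (𝟙_ C) X N).inv := by
  rw [← cancel_epi ((λ_ X).hom ⊵ₗ N), hom_inv_actionHomLeft]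
  simp

theorem rightUnitor_inv_actionHom (X : C) (N : D) :
    (ρ_ X).inv ⊵ₗ N = X ⊴ₗ (λₗ N).inv ≫ (αₗ X (𝟙_ C) N).inv := by
  rw [← cancel_epi ((ρ_ X).hom ⊵ₗ N), hom_inv_actionHomLeft]
  simp

theorem associator_hom_actionHom (X Y Z : C) (N : D) :
    (α_ X Y Z).hom ⊵ₗ N = (αₗ (X ⊗ Y) Z N).hom ≫ (αₗ X Y (Z ⊙ₗ N)).hom ≫
      X ⊴ₗ (αₗ Y Z N).inv ≫ (αₗ X (Y ⊗ Z) N).inv := by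
  rw [← associator_actionHom_assoc]
  simp

/-- A triangle identity of the duality, acting on `N` and rewritten with the coherence isomorphisms
of the action. -/
theorem zigzag_action_left (X Y : C) [ExactPairing X Y] (N : D) :
    Y ⊴ₗ (λₗ N).inv ≫ Y ⊴ₗ η_ X Y ⊵ₗ N ≫ Y ⊴ₗ (αₗ X Y N).hom ≫ (αₗ Y X (Y ⊙ₗ N)).inv ≫
      ε_ X Y ⊵ₗ (Y ⊙ₗ N) = (λₗ (Y ⊙ₗ N)).inv := by
  have h := congrArg (fun f => Y ⊴ₗ (λₗ N).inv ≫ (αₗ Y (𝟙_ C) N).inv ≫ f ⊵ₗ N ≫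
    (αₗ (𝟙_ C) Y N).hom) (ExactPairing.coevaluation_evaluation X Y)
  simpa [-ExactPairing.coevaluation_evaluation, associator_inv_actionHom,
    leftUnitor_inv_actionHom] using h

theorem zigzag_action_right (X Y : C) [ExactPairing X Y] (N : D) :
    η_ X Y ⊵ₗ (X ⊙ₗ N) ≫ (αₗ X Y (X ⊙ₗ N)).hom ≫
      X ⊴ₗ (αₗ Y X N).inv ≫ X ⊴ₗ ε_ X Y ⊵ₗ N ≫ X ⊴ₗ (λₗ N).hom = (λₗ (X ⊙ₗ N)).hom := by
  have h := congrArg (fun f => (αₗ (𝟙_ C) X N).inv ≫ f ⊵ₗ N ≫ (αₗ X (𝟙_ C) N).hom ≫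
    X ⊴ₗ (λₗ N).hom) (ExactPairing.evaluation_coevaluation X Y)
  simpa [-ExactPairing.evaluation_coevaluation, associator_hom_actionHom,
    rightUnitor_inv_actionHom] using h

/-- Acting with a dual is adjoint to acting with the object. -/
def actionHomEquiv (X Y : C) [ExactPairing X Y] (N Z : D) :
    (Y ⊙ₗ N ⟶ Z) ≃ (N ⟶ X ⊙ₗ Z) where
  toFun f := (λₗ N).inv ≫ η_ X Y ⊵ₗ N ≫ (αₗ X Y N).hom ≫ X ⊴ₗ f
  invFun g := Y ⊴ₗ g ≫ (αₗ Y X Z).inv ≫ ε_ X Y ⊵ₗ Z ≫ (λₗ Z).hom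
  left_inv f := by
    have h1 : Y ⊴ₗ X ⊴ₗ f ≫ (αₗ Y X Z).inv ≫ ε_ X Y ⊵ₗ Z =
        (αₗ Y X (Y ⊙ₗ N)).inv ≫ ε_ X Y ⊵ₗ (Y ⊙ₗ N) ≫ (𝟙_ C) ⊴ₗ f := by
      rw [← action_exchange, tensor_actionHomRight]
      simp
    simp only [actionHomRight_comp, Category.assoc]
    rw [reassoc_of% h1, ← actionUnitIso_hom_naturality]
    have h := zigzag_action_left X Y N
    simp only [← Category.assoc] at h ⊢
    rw [h]
    simp
  right_inv g := by
    have h1 : g ≫ (λₗ (X ⊙ₗ Z)).inv ≫ η_ X Y ⊵ₗ (X ⊙ₗ Z) ≫ (αₗ X Y (X ⊙ₗ Z)).hom =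
        (λₗ N).inv ≫ η_ X Y ⊵ₗ N ≫ (αₗ X Y N).hom ≫ X ⊴ₗ Y ⊴ₗ g := by
      rw [← actionUnitIso_inv_naturality_assoc, action_exchange_assoc, tensor_actionHomRight]
      simp
    simp only [actionHomRight_comp]
    rw [← reassoc_of% h1, zigzag_action_right]
    simp

/-- Move `X` across by duality, apply the universal property of `H`, and move `X` back: `Hom(W, X ⊗
H) ≃ Hom(Xᵛ ⊗ W, H) ≃ Hom((Xᵛ ⊗ W) ⊙ M, N) ≃ Hom(W ⊙ M, X ⊙ N)`. -/
theorem isInternalHom_tensor {M N : D} {H : C} {ev : H ⊙ₗ M ⟶ N} (h : IsInternalHom M N H ev)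
    (X : C) [HasRightDual X] :
    IsInternalHom M (X ⊙ₗ N) (X ⊗ H) ((αₗ X H M).hom ≫ X ⊴ₗ ev) := by
  intro W
  let e := ((tensorLeftHomEquiv W X (HasRightDual.rightDual X) H).symm.trans
    (Equiv.ofBijective _ (h (HasRightDual.rightDual X ⊗ W)))).trans
    (((αₗ (HasRightDual.rightDual X) W M).homCongr (Iso.refl N)).trans
      (actionHomEquiv X (HasRightDual.rightDual X) (W ⊙ₗ M) N))
  convert e.bijective using 1
  funext f
  -- Writing `f` as the mate of `g` cancels the first equivalence in `e`; only a coherence identity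
  -- remains.
  obtain ⟨g, rfl⟩ := (tensorLeftHomEquiv W X (HasRightDual.rightDual X) H).surjective f
  simp [e, actionHomEquiv]
  simp [tensorLeftHomEquiv, leftUnitor_inv_actionHom, associator_hom_actionHom]

end Duality

/-! ## The module functor given by internal Homs -/

open MonoidalLeftAction

/-- A choice of internal Homs from `M` to all objects. -/
structure InternalHoms (C : Type u) [Category.{v} C] [MonoidalCategory C]
    {D : Type u₁} [Category.{v₁} D] [MonoidalLeftAction C D] (M : D) where
  /-- The internal Hom to `N`. -/
  obj : D → C
  /-- The evaluation. -/
  ev : ∀ N : D, obj N ⊙ₗ M ⟶ N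
  isInternalHom : ∀ N : D, IsInternalHom M N (obj N) (ev N)

namespace InternalHoms

variable {C : Type u} [Category.{v} C] [MonoidalCategory C]
  {D : Type u₁} [Category.{v₁} D] [MonoidalLeftAction C D] {M : D} (I : InternalHoms C M)

/-- Uniqueness in the universal property: identities between maps into an internal Hom are checked
after evaluation. -/
theorem hom_ext {X : C} {N : D} {f g : X ⟶ I.obj N}
    (h : f ⊵ₗ M ≫ I.ev N = g ⊵ₗ M ≫ I.ev N) : f = g :=
  (I.isInternalHom N X).1 h

/-- The morphism to the internal Hom corresponding to `g`. -/
noncomputable def lift {X : C} {N : D} (g : X ⊙ₗ M ⟶ N) : X ⟶ I.obj N :=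
  ((I.isInternalHom N X).2 g).choose

@[simp]
theorem lift_ev {X : C} {N : D} (g : X ⊙ₗ M ⟶ N) : I.lift g ⊵ₗ M ≫ I.ev N = g :=
  ((I.isInternalHom N X).2 g).choose_spec

theorem whiskerRight_ev {X Y Z : C} (f : X ⟶ Y) {N : D} (g : Z ⊙ₗ M ⟶ N) :
    (f ▷ Z) ⊵ₗ M ≫ (αₗ Y Z M).hom ≫ Y ⊴ₗ g = (αₗ X Z M).hom ≫ X ⊴ₗ g ≫ f ⊵ₗ N := by
  rw [action_exchange, whiskerRight_actionHomLeft]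
  simp only [Category.assoc, Iso.inv_hom_id_assoc]

theorem whiskerLeft_ev (X : C) {Y Z : C} (f : Y ⟶ Z) {N : D} (g : Z ⊙ₗ M ⟶ N) :
    (X ◁ f) ⊵ₗ M ≫ (αₗ X Z M).hom ≫ X ⊴ₗ g = (αₗ X Y M).hom ≫ X ⊴ₗ (f ⊵ₗ M ≫ g) := by
  simp

/-- The action of the internal endomorphisms of `M` on an internal Hom. -/
noncomputable def act (N : D) : I.obj N ⊗ I.obj M ⟶ I.obj N :=
  I.lift ((αₗ (I.obj N) (I.obj M) M).hom ≫ I.obj N ⊴ₗ I.ev M ≫ I.ev N)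

theorem act_ev (N : D) : I.act N ⊵ₗ M ≫ I.ev N =
    (αₗ (I.obj N) (I.obj M) M).hom ≫ I.obj N ⊴ₗ I.ev M ≫ I.ev N := I.lift_ev _

/-- The unit of the internal endomorphisms. -/
noncomputable def unit : 𝟙_ C ⟶ I.obj M := I.lift (λₗ M).hom

theorem unit_ev : I.unit ⊵ₗ M ≫ I.ev M = (λₗ M).hom := I.lift_ev _

theorem act_unit (N : D) : I.obj N ◁ I.unit ≫ I.act N = (ρ_ (I.obj N)).hom := by
  apply I.hom_ext
  rw [comp_actionHomLeft, Category.assoc, act_ev, reassoc_of% whiskerLeft_ev, unit_ev]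
  simp

theorem act_act (N : D) : I.act N ▷ I.obj M ≫ I.act N =
    (α_ (I.obj N) (I.obj M) (I.obj M)).hom ≫ I.obj N ◁ I.act M ≫ I.act N := by
  apply I.hom_ext
  simp only [comp_actionHomLeft, Category.assoc, act_ev, reassoc_of% whiskerLeft_ev,
    reassoc_of% whiskerRight_ev, associator_hom_actionHom, actionHomRight_comp, tensor_actionHomRight,
    Iso.inv_hom_id_assoc, actionHomRight_inv_hom_assoc]

/-- The algebra of internal endomorphisms. -/
noncomputable instance : MonObj (I.obj M) where
  one := I.unit
  mul := I.act M
  one_mul := by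
    apply I.hom_ext
    rw [comp_actionHomLeft, Category.assoc, act_ev, reassoc_of% whiskerRight_ev, unit_ev]
    simp
  mul_one := I.act_unit M
  mul_assoc := I.act_act M

theorem isInternalEnd : IsInternalEnd M (I.obj M) :=
  ⟨I.ev M, I.isInternalHom M, I.act_ev M, I.unit_ev⟩

/-- The functorial action of internal Homs. -/
noncomputable def map {N P : D} (f : N ⟶ P) : I.obj N ⟶ I.obj P := I.lift (I.ev N ≫ f)

theorem map_ev {N P : D} (f : N ⟶ P) : I.map f ⊵ₗ M ≫ I.ev P = I.ev N ≫ f := I.lift_ev _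

theorem act_map {N P : D} (f : N ⟶ P) :
    I.act N ≫ I.map f = I.map f ▷ I.obj M ≫ I.act P := by
  apply I.hom_ext
  simp only [comp_actionHomLeft, Category.assoc, act_ev, reassoc_of% I.act_ev, reassoc_of% whiskerRight_ev,
    map_ev]

/-- The functor from a category with an action to modules over internal endomorphisms. -/
@[simps]
noncomputable def functor : D ⥤ RightMod (I.obj M) where
  obj N :=
    { X := I.obj N
      act := I.act N
      act_one := I.act_unit N
      act_mul := I.act_act N }
  map f := { hom := I.map f, comm := I.act_map f }
  map_id N := RightMod.hom_ext <| I.hom_ext <| by simp [map_ev]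
  map_comp f g := RightMod.hom_ext <| I.hom_ext <| by simp [map_ev, reassoc_of% I.map_ev]

/-- The comparison between tensoring with internal Homs and internal Homs of tensors. -/
noncomputable def tensorComparison (X : C) (N : D) : X ⊗ I.obj N ⟶ I.obj (X ⊙ₗ N) :=
  I.lift ((αₗ X (I.obj N) M).hom ≫ X ⊴ₗ I.ev N)

theorem tensorComparison_ev (X : C) (N : D) :
    I.tensorComparison X N ⊵ₗ M ≫ I.ev (X ⊙ₗ N) = (αₗ X (I.obj N) M).hom ≫ X ⊴ₗ I.ev N :=
  I.lift_ev _

/-- Source and target represent the same functor, by `isInternalHom_tensor`, and the comparison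
respects the universal elements. -/
theorem isIso_tensorComparison (X : C) [HasRightDual X] (N : D) :
    IsIso (I.tensorComparison X N) := by
  have h := isInternalHom_tensor (I.isInternalHom N) X
  obtain ⟨g, hg⟩ := (h (I.obj (X ⊙ₗ N))).2 (I.ev (X ⊙ₗ N))
  refine ⟨g, (h _).1 ?_, I.hom_ext ?_⟩
  · dsimp only at hg ⊢
    rw [comp_actionHomLeft, Category.assoc, hg, tensorComparison_ev]
    simp
  · dsimp only at hg
    rw [comp_actionHomLeft, Category.assoc, tensorComparison_ev, hg]
    simp

theorem act_tensorComparison (X : C) (N : D) :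
    ((α_ X (I.obj N) (I.obj M)).hom ≫ X ◁ I.act N) ≫ I.tensorComparison X N =
      I.tensorComparison X N ▷ I.obj M ≫ I.act (X ⊙ₗ N) := by
  apply I.hom_ext
  simp only [comp_actionHomLeft, Category.assoc, act_ev, tensorComparison_ev,
    reassoc_of% whiskerRight_ev, whiskerLeft_ev, associator_hom_actionHom, actionHomRight_comp,
    tensor_actionHomRight, Iso.inv_hom_id_assoc, actionHomRight_inv_hom_assoc]

noncomputable instance : I.functor.LaxLeftLinear C where
  μₗ X N := { hom := I.tensorComparison X N, comm := I.act_tensorComparison X N }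
  μₗ_naturality_left {X Y} f N := RightMod.hom_ext <| I.hom_ext <| by
    change (f ▷ I.obj N ≫ I.tensorComparison Y N) ⊵ₗ M ≫ _ =
      (I.tensorComparison X N ≫ I.map (f ⊵ₗ N)) ⊵ₗ M ≫ _
    simp only [comp_actionHomLeft, Category.assoc, tensorComparison_ev, map_ev,
      reassoc_of% I.tensorComparison_ev, whiskerRight_ev]
  μₗ_naturality_right X {N P} f := RightMod.hom_ext <| I.hom_ext <| by
    change (X ◁ I.map f ≫ I.tensorComparison X P) ⊵ₗ M ≫ _ =
      (I.tensorComparison X N ≫ I.map (X ⊴ₗ f)) ⊵ₗ M ≫ _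
    simp only [comp_actionHomLeft, Category.assoc, tensorComparison_ev, map_ev,
      reassoc_of% I.tensorComparison_ev, whiskerLeft_ev, actionHomRight_comp]
  μₗ_associativity X Y N := RightMod.hom_ext <| I.hom_ext <| by
    change (I.tensorComparison (X ⊗ Y) N ≫ I.map (αₗ X Y N).hom) ⊵ₗ M ≫ _ =
      ((α_ X Y (I.obj N)).hom ≫ X ◁ I.tensorComparison Y N ≫
        I.tensorComparison X (Y ⊙ₗ N)) ⊵ₗ M ≫ _
    simp only [comp_actionHomLeft, Category.assoc, tensorComparison_ev, map_ev,
      reassoc_of% I.tensorComparison_ev, whiskerLeft_ev, associator_hom_actionHom, actionHomRight_comp,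
      tensor_actionHomRight, Iso.inv_hom_id_assoc, actionHomRight_inv_hom_assoc, Iso.inv_hom_id,
      Category.comp_id]
  μₗ_unitality N := RightMod.hom_ext <| I.hom_ext <| by
    change (λ_ (I.obj N)).hom ⊵ₗ M ≫ _ =
      (I.tensorComparison (𝟙_ C) N ≫ I.map (λₗ N).hom) ⊵ₗ M ≫ _
    simp only [comp_actionHomLeft, Category.assoc, reassoc_of% I.tensorComparison_ev, map_ev]
    simp

instance [∀ X : C, HasRightDual X] (X : C) (N : D) :
    IsIso (Functor.LaxLeftLinear.μₗ I.functor X N) := by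
  have : IsIso (RightMod.Hom.hom (Functor.LaxLeftLinear.μₗ I.functor X N)) :=
    I.isIso_tensorComparison X N
  exact RightMod.isIso_of_isIso_hom _

end InternalHoms

/-- A lax linear functor whose structure morphisms are isomorphisms is linear. -/
@[reducible]
noncomputable def leftLinearOfIsIso {C : Type u} [Category.{v} C] [MonoidalCategory C]
    {D : Type u₁} [Category.{v₁} D] [MonoidalLeftAction C D]
    {E : Type u₂} [Category.{v₂} E] [MonoidalLeftAction C E] (F : D ⥤ E) [F.LaxLeftLinear C]
    [∀ (X : C) (N : D), IsIso (Functor.LaxLeftLinear.μₗ F X N)] : F.LeftLinear C where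
  δₗ X N := inv (Functor.LaxLeftLinear.μₗ F X N)
  δₗ_naturality_left f N := by
    rw [IsIso.eq_inv_comp, ← Functor.LaxLeftLinear.μₗ_naturality_left_assoc]
    simp
  δₗ_naturality_right X _ _ f := by
    rw [IsIso.eq_inv_comp, ← Functor.LaxLeftLinear.μₗ_naturality_right_assoc]
    simp
  δₗ_associativity X Y N := by
    rw [IsIso.inv_comp_eq, ← Category.assoc, Functor.LaxLeftLinear.μₗ_associativity]
    simp
  δₗ_unitality_inv N := by
    rw [← Functor.LaxLeftLinear.μₗ_unitality_inv_assoc]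
    simp
  μₗ_comp_δₗ X N := by simp
  δₗ_comp_μₗ X N := by simp

/-! ### The canonical free presentation of a module -/

namespace RightMod

variable {C : Type u} [Category.{v} C] [MonoidalCategory C] {A : C} [MonObj A]

/-- The action of a right module, as a morphism from a free module. -/
def fromFree (P : RightMod A) : P.X ⊙ₗ regular A ⟶ P where
  hom := P.act
  comm := (Category.assoc (α_ P.X A A).hom (P.X ◁ μ[A]) P.act).trans P.act_mul.symm

/-- The pair `P ⊗ A ⊗ A ⇉ P ⊗ A` is split in `C` by the unit of `A`, which gives an explicit
factorization through `P.act`. -/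
theorem act_comp_unit (P : RightMod A) {Z : C} (e : P.X ⊗ A ⟶ Z)
    (h : P.act ▷ A ≫ e = (α_ P.X A A).hom ≫ P.X ◁ μ[A] ≫ e) :
    P.act ≫ (ρ_ P.X).inv ≫ P.X ◁ η[A] ≫ e = e := by
  have h2 : P.act ≫ (ρ_ P.X).inv ≫ P.X ◁ η[A] ≫ e =
      (ρ_ (P.X ⊗ A)).inv ≫ (P.X ⊗ A) ◁ η[A] ≫ P.act ▷ A ≫ e := by
    rw [whisker_exchange_assoc]
    simp
  rw [h2, h]
  simp [← MonoidalCategory.whiskerLeft_comp_assoc]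

/-- A linear map out of a free module is the linear extension of its restriction along the unit.
This makes the factorization above linear. -/
theorem unit_comp_act (P Z : RightMod A) (e : P.X ⊗ A ⟶ Z.X)
    (h : ((α_ P.X A A).hom ≫ P.X ◁ μ[A]) ≫ e = e ▷ A ≫ Z.act) :
    ((ρ_ P.X).inv ≫ P.X ◁ η[A] ≫ e) ▷ A ≫ Z.act = e := by
  simp only [comp_whiskerRight, Category.assoc, ← h]
  simp [← MonoidalCategory.whiskerLeft_comp_assoc]

/-- A morphism from the canonical free cover that coequalizes the canonical presentation factors
through the module. -/
theorem exists_fac_fromFree (P : RightMod A) {Z : RightMod A} (e : P.X ⊙ₗ regular A ⟶ Z)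
    (h : P.act ⊵ₗ regular A ≫ e =
      ((αₗ P.X A (regular A)).hom ≫ P.X ⊴ₗ (regular A).fromFree) ≫ e) :
    ∃ j : P ⟶ Z, P.fromFree ≫ j = e := by
  have h1 := P.act_comp_unit e.hom
    ((congrArg Hom.hom h).trans (Category.assoc (α_ P.X A A).hom (P.X ◁ μ[A]) e.hom))
  exact ⟨{ hom := (ρ_ P.X).inv ≫ P.X ◁ η[A] ≫ e.hom
           comm := h1.trans (P.unit_comp_act Z e.hom e.comm).symm }, hom_ext h1⟩

theorem presentation_comp_fromFree (P : RightMod A) :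
    P.act ⊵ₗ regular A ≫ P.fromFree =
      ((αₗ P.X A (regular A)).hom ≫ P.X ⊴ₗ (regular A).fromFree) ≫ P.fromFree :=
  hom_ext (P.act_mul.trans (Category.assoc (α_ P.X A A).hom (P.X ◁ μ[A]) P.act).symm)

/-- The unit of `A` gives a section of `P.act` in `C`, though not in general a linear one. -/
instance (P : RightMod A) : Epi P.fromFree where
  left_cancellation {Z} f g h := by
    have key : ∀ t : P.X ⟶ Z.X, ((ρ_ P.X).inv ≫ P.X ◁ η[A]) ≫ P.act ≫ t = t := by
      intro t
      rw [Category.assoc, ← Category.assoc (P.X ◁ η[A]), P.act_one, Iso.inv_hom_id_assoc]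
    have h1 : P.act ≫ f.hom = P.act ≫ g.hom := congrArg Hom.hom h
    ext
    rw [← key f.hom, h1, key]

variable [Preadditive C] [MonoidalPreadditive C]

theorem nonempty_retract_of_isRegularHom (P : RightMod A)
    (hreg : ∀ {X Y : C} (f : X ⊙ₗ regular A ⟶ Y ⊙ₗ regular A), IsRegularHom f) :
    Nonempty (Retract P (P.X ⊙ₗ regular A)) := by
  let a : (P.X ⊗ A) ⊙ₗ regular A ⟶ P.X ⊙ₗ regular A := P.act ⊵ₗ regular A
  let b : (P.X ⊗ A) ⊙ₗ regular A ⟶ P.X ⊙ₗ regular A :=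
    (αₗ P.X A (regular A)).hom ≫ P.X ⊴ₗ (regular A).fromFree
  obtain ⟨s, hs⟩ := hreg (a - b)
  have hq : (a - b) ≫ P.fromFree = 0 := by
    rw [Preadditive.sub_comp, sub_eq_zero]
    exact P.presentation_comp_fromFree
  -- This endomorphism is killed by `a - b` on the left, so it descends along `P.fromFree`. Since
  -- `(a - b) ≫ P.fromFree = 0`, the result is a section.
  obtain ⟨j, hj⟩ := P.exists_fac_fromFree (𝟙 _ - s ≫ (a - b)) (by
    have : (a - b) ≫ (𝟙 _ - s ≫ (a - b)) = 0 := by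
      rw [Preadditive.comp_sub, hs]
      simp
    rwa [Preadditive.sub_comp, sub_eq_zero] at this)
  refine ⟨{ i := j, r := P.fromFree, retract := ?_ }⟩
  rw [← cancel_epi P.fromFree, ← Category.assoc, hj, Preadditive.sub_comp, Category.assoc, hq]
  simp

end RightMod

/-- Fullness lifts the idempotent on `F.obj Z`, faithfulness keeps it idempotent, and its splitting
in `D` is the required object. -/
theorem exists_iso_of_retract {D : Type u} [Category.{v} D] {E : Type u₁} [Category.{v₁} E]
    [IsIdempotentComplete D] (F : D ⥤ E) [F.Full] [F.Faithful] {P : E} {Z : D}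
    (r : Retract P (F.obj Z)) : ∃ Y : D, Nonempty (F.obj Y ≅ P) := by
  obtain ⟨p, hp⟩ := F.map_surjective (r.r ≫ r.i)
  obtain ⟨Y, i, e, hie, hei⟩ := IsIdempotentComplete.idempotents_split Z p
    (F.map_injective (by simp [hp]))
  refine ⟨Y, ⟨{ hom := F.map i ≫ r.r, inv := r.i ≫ F.map e, hom_inv_id := ?_, inv_hom_id := ?_ }⟩⟩
  · have : F.map i ≫ (r.r ≫ r.i) ≫ F.map e = 𝟙 _ := by
      rw [← hp, ← hei, ← F.map_comp, ← F.map_comp, Category.assoc, hie, reassoc_of% hie,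
        F.map_id]
    simpa using this
  · have : r.i ≫ (F.map e ≫ F.map i) ≫ r.r = 𝟙 _ := by
      rw [← F.map_comp, hei, hp]
      simp
    simpa using this

/-! ### Internal Homs from a generator give an equivalence -/

namespace InternalHoms

variable {C : Type u} [Category.{v} C] [MonoidalCategory C]
  {D : Type u₁} [Category.{v₁} D] [MonoidalLeftAction C D] {M : D} (I : InternalHoms C M)

/-- The coevaluation. -/
noncomputable def coev (X : C) : X ⟶ I.obj (X ⊙ₗ M) := I.lift (𝟙 _)

theorem coev_map_ev (X : C) {N : D} (f : X ⊙ₗ M ⟶ N) :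
    (I.coev X ≫ I.map f) ⊵ₗ M ≫ I.ev N = f := by
  rw [comp_actionHomLeft, Category.assoc, map_ev, coev, reassoc_of% I.lift_ev, Category.id_comp]

/-- The linear extension of the coevaluation is the comparison map. When that is invertible, the
image of `X ⊙ₗ M` is free on `X` with `coev` as its generators. -/
theorem coev_act (X : C) :
    I.coev X ▷ I.obj M ≫ I.act (X ⊙ₗ M) = I.tensorComparison X M := by
  apply I.hom_ext
  rw [comp_actionHomLeft, Category.assoc, act_ev, reassoc_of% whiskerRight_ev, coev, lift_ev,
    tensorComparison_ev, Category.comp_id]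

theorem tensorComparison_comp (X : C) {P : RightMod (I.obj M)} (f : I.obj (X ⊙ₗ M) ⟶ P.X)
    (hf : I.act (X ⊙ₗ M) ≫ f = f ▷ I.obj M ≫ P.act) :
    I.tensorComparison X M ≫ f = (I.coev X ≫ f) ▷ I.obj M ≫ P.act := by
  rw [comp_whiskerRight, Category.assoc, ← hf, ← I.coev_act, Category.assoc]

theorem hom_ext_of_coev {X : C} [HasRightDual X] {P : RightMod (I.obj M)}
    {f g : I.functor.obj (X ⊙ₗ M) ⟶ P} (h : I.coev X ≫ f.hom = I.coev X ≫ g.hom) : f = g := by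
  have := I.isIso_tensorComparison X M
  have h1 : I.tensorComparison X M ≫ f.hom = I.tensorComparison X M ≫ g.hom :=
    (I.tensorComparison_comp X f.hom f.comm).trans
      ((congrArg (fun t => t ▷ I.obj M ≫ P.act) h).trans
        (I.tensorComparison_comp X g.hom g.comm).symm)
  exact RightMod.hom_ext ((cancel_epi (I.tensorComparison X M)).1 h1)

theorem faithful_functor
    (hgen : ∀ N : D, ∃ X : C, Nonempty (Retract N (X ⊙ₗ M))) : I.functor.Faithful where
  map_injective {N P} f g h := by
    obtain ⟨X, ⟨r⟩⟩ := hgen N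
    have h1 : I.functor.map (r.r ≫ f) = I.functor.map (r.r ≫ g) := by
      rw [Functor.map_comp, h, Functor.map_comp]
    have h2 : r.r ≫ f = r.r ≫ g := by
      rw [← I.coev_map_ev X (r.r ≫ f), ← I.coev_map_ev X (r.r ≫ g)]
      have := congrArg RightMod.Hom.hom h1
      simp only [functor_map_hom] at this
      rw [this]
    rw [← Category.id_comp f, ← r.retract, Category.assoc, h2, r.retract_assoc]

theorem full_functor [∀ X : C, HasRightDual X]
    (hgen : ∀ N : D, ∃ X : C, Nonempty (Retract N (X ⊙ₗ M))) : I.functor.Full where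
  map_surjective {N P} φ := by
    obtain ⟨X, ⟨r⟩⟩ := hgen N
    -- On `X ⊙ₗ M` the preimage is the mate of the restriction along `coev`; precomposing with `r.i`
    -- transfers it to `N`.
    have h1 : I.functor.map (((I.coev X) ≫ (I.functor.map r.r ≫ φ).hom) ⊵ₗ M ≫ I.ev P) =
        I.functor.map r.r ≫ φ := by
      apply I.hom_ext_of_coev
      apply I.hom_ext
      exact I.coev_map_ev X _
    refine ⟨r.i ≫ ((I.coev X) ≫ (I.functor.map r.r ≫ φ).hom) ⊵ₗ M ≫ I.ev P, ?_⟩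
    rw [Functor.map_comp, h1, ← Category.assoc, ← Functor.map_comp, r.retract]
    simp

theorem isEquivalence_functor [Preadditive C] [MonoidalPreadditive C]
    [∀ X : C, HasRightDual X] [IsIdempotentComplete D]
    (hgen : ∀ N : D, ∃ X : C, Nonempty (Retract N (X ⊙ₗ M)))
    (hreg : ∀ {X Y : D} (f : X ⟶ Y), IsRegularHom f) : I.functor.IsEquivalence := by
  have := I.faithful_functor hgen
  have := I.full_functor hgen
  let e (X : C) : X ⊙ₗ I.functor.obj M ≅ I.functor.obj (X ⊙ₗ M) :=
    asIso (Functor.LaxLeftLinear.μₗ I.functor X M)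
  have hr {X Y : C} (f : X ⊙ₗ I.functor.obj M ⟶ Y ⊙ₗ I.functor.obj M) : IsRegularHom f := by
    obtain ⟨g, hg⟩ := I.functor.map_surjective ((e X).inv ≫ f ≫ (e Y).hom)
    obtain ⟨s, hs⟩ := hreg g
    refine ⟨(e Y).hom ≫ I.functor.map s ≫ (e X).inv, ?_⟩
    have h1 : I.functor.map g ≫ I.functor.map s ≫ I.functor.map g = I.functor.map g := by
      rw [← Functor.map_comp, ← Functor.map_comp, hs]
    rw [hg] at h1
    rw [← cancel_epi (e X).inv, ← cancel_mono (e Y).hom]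
    simpa only [Category.assoc] using h1
  refine { essSurj := ⟨fun P => ?_⟩ }
  -- `I.functor.obj M` is definitionally the regular module, so `hr` concerns maps between free
  -- modules.
  obtain ⟨r⟩ := P.nonempty_retract_of_isRegularHom hr
  exact exists_iso_of_retract I.functor (r.trans (Retract.ofIso (e P.X)))

end InternalHoms

/-! ## Existence of internal Homs of right modules -/

namespace RightMod

variable {C : Type u} [Category.{v} C] [MonoidalCategory C] {A : C} [MonObj A]

theorem tensorRightHomEquiv_comp {X X' Y Y' Z : C} [ExactPairing Y Y'] (f : X ⟶ X')
    (g : X' ⊗ Y ⟶ Z) :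
    tensorRightHomEquiv X Y Y' Z (f ▷ Y ≫ g) = f ≫ tensorRightHomEquiv X' Y Y' Z g := by
  rw [← Equiv.eq_symm_apply, tensorRightHomEquiv_symm_naturality, Equiv.symm_apply_apply]

/-- Dualizing `Y ⊗ B` isolates `f`, so that a linearity condition becomes an equalizer condition on
`f`. -/
theorem tensorRightHomEquiv_assoc_comp_eq_iff {X X' Y B Z : C} [HasRightDual (Y ⊗ B)] (f : X ⟶ X')
    (g h : (X' ⊗ Y) ⊗ B ⟶ Z) :
    f ▷ Y ▷ B ≫ g = f ▷ Y ▷ B ≫ h ↔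
      f ≫ tensorRightHomEquiv X' (Y ⊗ B) (HasRightDual.rightDual (Y ⊗ B)) Z ((α_ X' Y B).inv ≫ g) =
      f ≫ tensorRightHomEquiv X' (Y ⊗ B) (HasRightDual.rightDual (Y ⊗ B)) Z
        ((α_ X' Y B).inv ≫ h) := by
  rw [← tensorRightHomEquiv_comp, ← tensorRightHomEquiv_comp, Equiv.apply_eq_iff_eq,
    associator_inv_naturality_left_assoc, associator_inv_naturality_left_assoc,
    cancel_epi (α_ X Y B).inv]

variable [∀ X : C, HasRightDual X] [HasEqualizers C]

theorem exists_isInternalHom (M N : RightMod A) :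
    ∃ (H : C) (ev : H ⊙ₗ M ⟶ N), IsInternalHom M N H ev := by
  let G : C := N.X ⊗ HasRightDual.rightDual M.X
  let φ (X : C) := tensorRightHomEquiv X M.X (HasRightDual.rightDual M.X) N.X
  let ε : G ⊗ M.X ⟶ N.X := (φ G).symm (𝟙 G)
  let u : (G ⊗ M.X) ⊗ A ⟶ N.X := ((α_ G M.X A).hom ≫ G ◁ M.act) ≫ ε
  let v : (G ⊗ M.X) ⊗ A ⟶ N.X := ε ▷ A ≫ N.act
  let ψ := tensorRightHomEquiv G (M.X ⊗ A) (HasRightDual.rightDual (M.X ⊗ A)) N.X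
  let u' := ψ ((α_ G M.X A).inv ≫ u)
  let v' := ψ ((α_ G M.X A).inv ≫ v)
  have hε {X : C} (f : X ⟶ G) : (φ X).symm f = f ▷ M.X ≫ ε := by
    have := tensorRightHomEquiv_symm_naturality (Y := M.X) f (𝟙 G)
    rwa [Category.comp_id] at this
  -- Maps into the equalizer of `u'` and `v'` are exactly those whose mates `X ⊗ M.X ⟶ N.X` are
  -- `A`-linear.
  have hlin {X : C} (f : X ⟶ G) : f ≫ u' = f ≫ v' ↔
      ((α_ X M.X A).hom ≫ X ◁ M.act) ≫ f ▷ M.X ≫ ε = (f ▷ M.X ≫ ε) ▷ A ≫ N.act := by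
    rw [← tensorRightHomEquiv_assoc_comp_eq_iff]
    simp [u, v, whisker_exchange_assoc]
  let H := equalizer u' v'
  let ev : H ⊙ₗ M ⟶ N :=
    { hom := equalizer.ι u' v' ▷ M.X ≫ ε
      comm := (hlin _).1 (equalizer.condition u' v') }
  refine ⟨H, ev, fun X => ⟨fun f g h => ?_, fun g => ?_⟩⟩
  · have h1 : f ▷ M.X ≫ equalizer.ι u' v' ▷ M.X ≫ ε =
        g ▷ M.X ≫ equalizer.ι u' v' ▷ M.X ≫ ε := congrArg Hom.hom h
    rw [← comp_whiskerRight_assoc, ← comp_whiskerRight_assoc, ← hε, ← hε] at h1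
    exact equalizer.hom_ext ((φ X).symm.injective h1)
  · have hg : φ X g.hom ▷ M.X ≫ ε = g.hom :=
      (hε _).symm.trans ((φ X).symm_apply_apply g.hom)
    have h1 : φ X g.hom ≫ u' = φ X g.hom ≫ v' := by
      rw [hlin, hg]
      exact g.comm
    refine ⟨equalizer.lift _ h1, hom_ext ?_⟩
    change equalizer.lift _ h1 ▷ M.X ≫ equalizer.ι u' v' ▷ M.X ≫ ε = g.hom
    rw [← comp_whiskerRight_assoc, equalizer.lift_ι, hg]

/-- Internal Homs of right modules. -/
noncomputable def internalHoms (M : RightMod A) : InternalHoms C M where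
  obj N := (exists_isInternalHom M N).choose
  ev N := (exists_isInternalHom M N).choose_spec.choose
  isInternalHom N := (exists_isInternalHom M N).choose_spec.choose_spec

end RightMod

/-! ## Full module subcategories -/

section FullSubcategory

variable {D : Type u₁} [Category.{v₁} D]

theorem isIdempotentComplete_fullSubcategory [IsIdempotentComplete D] (P : ObjectProperty D)
    (hP : ∀ {X Y : D}, Retract X Y → P Y → P X) : IsIdempotentComplete P.FullSubcategory where
  idempotents_split X p hp := by
    obtain ⟨Y, i, e, hie, hei⟩ := IsIdempotentComplete.idempotents_split X.obj p.hom
      (congrArg (fun f => f.hom) hp)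
    exact ⟨⟨Y, hP ⟨i, e, hie⟩ X.property⟩, ObjectProperty.homMk i, ObjectProperty.homMk e,
      ObjectProperty.hom_ext _ hie, ObjectProperty.hom_ext _ hei⟩

theorem hasFiniteProducts_fullSubcategory [Preadditive D] [HasZeroObject D]
    [HasBinaryBiproducts D] (P : ObjectProperty D) (hzero : ∀ X, IsZero X → P X)
    (hsum : ∀ X Y, P X → P Y → P (X ⊞ Y)) : HasFiniteProducts P.FullSubcategory := by
  have : P.ContainsZero := ⟨⟨_, isZero_zero D, hzero _ (isZero_zero D)⟩⟩
  have (X Y : P.FullSubcategory) : HasBinaryBiproduct X Y := by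
    let b : BinaryBicone X Y :=
      { pt := ⟨X.obj ⊞ Y.obj, hsum _ _ X.property Y.property⟩
        fst := ObjectProperty.homMk biprod.fst
        snd := ObjectProperty.homMk biprod.snd
        inl := ObjectProperty.homMk biprod.inl
        inr := ObjectProperty.homMk biprod.inr
        inl_fst := ObjectProperty.hom_ext _ biprod.inl_fst
        inl_snd := ObjectProperty.hom_ext _ biprod.inl_snd
        inr_fst := ObjectProperty.hom_ext _ biprod.inr_fst
        inr_snd := ObjectProperty.hom_ext _ biprod.inr_snd }
    exact hasBinaryBiproduct_of_total b (ObjectProperty.hom_ext _ biprod.total)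
  have : HasBinaryBiproducts P.FullSubcategory := ⟨this⟩
  exact hasFiniteProducts_of_has_binary_and_terminal

theorem isRegularHom_fullSubcategory (P : ObjectProperty D)
    (hreg : ∀ {X Y : D} (f : X ⟶ Y), IsRegularHom f) {X Y : P.FullSubcategory} (f : X ⟶ Y) :
    IsRegularHom f := by
  obtain ⟨s, hs⟩ := hreg f.hom
  exact ⟨ObjectProperty.homMk s, ObjectProperty.hom_ext _ hs⟩

/-- The restriction of an action to a full subcategory. -/
@[reducible]
def fullSubcategoryAction {C : Type u} [Category.{v} C] [MonoidalCategory C]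
    [MonoidalLeftAction C D] (P : ObjectProperty D) (hP : ∀ (X : C) (N : D), P N → P (X ⊙ₗ N)) :
    MonoidalLeftAction C P.FullSubcategory where
  actionObj X N := ⟨X ⊙ₗ N.obj, hP X N.obj N.property⟩
  actionHomLeft f N := ObjectProperty.homMk (f ⊵ₗ N.obj)
  actionHomRight X _ _ g := ObjectProperty.homMk (X ⊴ₗ g.hom)
  actionHom f g := ObjectProperty.homMk (f ⊙ₗₘ g.hom)
  actionAssocIso X Y N := P.isoMk (αₗ X Y N.obj)
  actionUnitIso N := P.isoMk (λₗ N.obj)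
  actionHom_def f g := ObjectProperty.hom_ext _ (actionHom_def f g.hom)
  actionHomRight_id X N := ObjectProperty.hom_ext _ (actionHomRight_id X N.obj)
  id_actionHomLeft X N := ObjectProperty.hom_ext _ (id_actionHomLeft X N.obj)
  actionHom_comp f₁ f₂ g₁ g₂ := ObjectProperty.hom_ext _ (actionHom_comp f₁ f₂ g₁.hom g₂.hom)
  actionAssocIso_hom_naturality f g h :=
    ObjectProperty.hom_ext _ (actionAssocIso_hom_naturality f g h.hom)
  actionUnitIso_hom_naturality f := ObjectProperty.hom_ext _ (actionUnitIso_hom_naturality f.hom)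
  whiskerLeft_actionHomLeft X _ _ f N :=
    ObjectProperty.hom_ext _ (whiskerLeft_actionHomLeft X f N.obj)
  whiskerRight_actionHomLeft X f N :=
    ObjectProperty.hom_ext _ (whiskerRight_actionHomLeft X f N.obj)
  associator_actionHom X Y Z N := ObjectProperty.hom_ext _ (associator_actionHom X Y Z N.obj)
  leftUnitor_actionHom X N := ObjectProperty.hom_ext _ (leftUnitor_actionHom X N.obj)
  rightUnitor_actionHom X N := ObjectProperty.hom_ext _ (rightUnitor_actionHom X N.obj)

end FullSubcategory

/-- The action of a linear monoidal category on a linear category is bilinear. -/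
structure IsBilinearAction (k : Type w) [Field k] (C : Type u) [Category.{v} C] [Preadditive C]
    [Linear k C] [MonoidalCategory C] (D : Type u₁) [Category.{v₁} D] [Preadditive D] [Linear k D]
    [MonoidalLeftAction C D] : Prop where
  action_add : ∀ (X : C) {N P : D} (f g : N ⟶ P), X ⊴ₗ (f + g) = X ⊴ₗ f + X ⊴ₗ g
  action_smul : ∀ (X : C) {N P : D} (c : k) (f : N ⟶ P), X ⊴ₗ (c • f) = c • X ⊴ₗ f
  add_action : ∀ {X Y : C} (f g : X ⟶ Y) (N : D), (f + g) ⊵ₗ N = f ⊵ₗ N + g ⊵ₗ N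
  smul_action : ∀ {X Y : C} (c : k) (f : X ⟶ Y) (N : D), (c • f) ⊵ₗ N = c • f ⊵ₗ N

section ModuleCategory

variable {k : Type w} [Field k] {C : Type u} [Category.{v} C] [Abelian C] [Linear k C]
  [MonoidalCategory C] {D : Type u₁} [Category.{v₁} D] [Preadditive D] [Linear k D]
  [MonoidalLeftAction C D]

/-- An abelian category with a bilinear action is a module category if all morphisms are von
Neumann regular. -/
def moduleCategoryOfRegular (k : Type w) [Field k] (C : Type u) [Category.{v} C] [Abelian C]
    [Linear k C] [MonoidalCategory C] (D : Type u₁) [Category.{v₁} D] [Abelian D] [Linear k D]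
    [MonoidalLeftAction C D] (h : IsBilinearAction k C D)
    (hC : ∀ {X Y : C} (f : X ⟶ Y), IsRegularHom f)
    (hD : ∀ {X Y : D} (f : X ⟶ Y), IsRegularHom f) : ModuleCategory.{w, v, u, v₁, u₁} k C :=
  have h1 (X : C) : ((curriedAction C D).obj X).Additive := ⟨fun {_ _ f g} => h.action_add X f g⟩
  have h2 (N : D) : ((curriedAction C D).flip.obj N).Additive :=
    ⟨fun {_ _ f g} => h.add_action f g N⟩
  { carrier := D
    additive_right := h1
    linear_right := fun X => ⟨fun {_ _} f c => h.action_smul X c f⟩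
    exact_right := fun _ => exact_of_regular hD _
    additive_left := h2
    linear_left := fun N => ⟨fun {_ _} f c => h.smul_action c f N⟩
    exact_left := fun _ => exact_of_regular hC _ }

/-- A full subcategory closed under retracts, finite direct sums and the action, as a module
category. -/
noncomputable def fullModuleSubcategory [IsIdempotentComplete D] [HasZeroObject D]
    [HasBinaryBiproducts D] (h : IsBilinearAction k C D)
    (hC : ∀ {X Y : C} (f : X ⟶ Y), IsRegularHom f) (hD : ∀ {X Y : D} (f : X ⟶ Y), IsRegularHom f)
    (P : ObjectProperty D) (hretract : ∀ {X Y : D}, Retract X Y → P Y → P X)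
    (hzero : ∀ X, IsZero X → P X) (hsum : ∀ X Y, P X → P Y → P (X ⊞ Y))
    (hact : ∀ (X : C) (N : D), P N → P (X ⊙ₗ N)) : ModuleCategory.{w, v, u, v₁, u₁} k C :=
  have := isIdempotentComplete_fullSubcategory P hretract
  have := hasFiniteProducts_fullSubcategory P hzero hsum
  letI : Abelian P.FullSubcategory := abelianOfRegular (isRegularHom_fullSubcategory P hD)
  letI := fullSubcategoryAction P hact
  moduleCategoryOfRegular k C P.FullSubcategory
    { action_add := fun X _ _ f g => ObjectProperty.hom_ext _ (h.action_add X f.hom g.hom)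
      action_smul := fun X _ _ c f => ObjectProperty.hom_ext _ (h.action_smul X c f.hom)
      add_action := fun f g N => ObjectProperty.hom_ext _ (h.add_action f g N.obj)
      smul_action := fun c f N => ObjectProperty.hom_ext _ (h.smul_action c f N.obj) }
    hC (isRegularHom_fullSubcategory P hD)

end ModuleCategory

/-! ## Orthogonal decompositions -/

section Decomposition

variable {D : Type u₁} [Category.{v₁} D] [Preadditive D]

/-- A decomposition of an object as the direct sum of objects with given properties. -/
structure Decomposition (P Q : ObjectProperty D) (N : D) where
  /-- The first summand. -/
  left : D
  /-- The second summand. -/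
  right : D
  left_prop : P left
  right_prop : Q right
  /-- The inclusion of the first summand. -/
  i : left ⟶ N
  /-- The projection to the first summand. -/
  p : N ⟶ left
  /-- The inclusion of the second summand. -/
  j : right ⟶ N
  /-- The projection to the second summand. -/
  q : N ⟶ right
  i_p : i ≫ p = 𝟙 left
  j_q : j ≫ q = 𝟙 right
  total : p ≫ i + q ≫ j = 𝟙 N

/-- Exchange the summands of a decomposition. -/
@[simps]
def Decomposition.swap {P Q : ObjectProperty D} {N : D} (d : Decomposition P Q N) :
    Decomposition Q P N where
  left := d.right
  right := d.left
  left_prop := d.right_prop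
  right_prop := d.left_prop
  i := d.j
  p := d.q
  j := d.i
  q := d.p
  i_p := d.j_q
  j_q := d.i_p
  total := by rw [add_comm, d.total]

variable {P Q : ObjectProperty D} (d : ∀ N, Decomposition P Q N)

namespace Decomposition

/-- The component of `f` in the `Q`-summand vanishes by orthogonality. -/
theorem comp_p_i {N : D} (d : Decomposition P Q N) (hPQ : ∀ X Y, P X → Q Y → ∀ f : X ⟶ Y, f = 0)
    {X : D} (hX : P X) (f : X ⟶ N) : f ≫ d.p ≫ d.i = f := by
  have h := congrArg (fun t => f ≫ t) d.total
  simp only [Preadditive.comp_add, ← Category.assoc f d.q,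
    hPQ _ _ hX d.right_prop (f ≫ d.q)] at h
  simpa using h

theorem p_i_comp {N : D} (d : Decomposition P Q N) (hQP : ∀ X Y, Q X → P Y → ∀ f : X ⟶ Y, f = 0)
    {Y : D} (hY : P Y) (f : N ⟶ Y) : d.p ≫ d.i ≫ f = f := by
  have h := congrArg (fun t => t ≫ f) d.total
  simp only [Preadditive.add_comp, Category.assoc, hQP _ _ d.right_prop hY (d.j ≫ f)] at h
  simpa using h

/-- The projection to the full subcategory of first summands. -/
@[simps]
def projection (hPQ : ∀ X Y, P X → Q Y → ∀ f : X ⟶ Y, f = 0) : D ⥤ P.FullSubcategory where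
  obj N := ⟨(d N).left, (d N).left_prop⟩
  map {N N'} f := ObjectProperty.homMk ((d N).i ≫ f ≫ (d N').p)
  map_id N := ObjectProperty.hom_ext _ (by simp [(d N).i_p])
  map_comp {N₁ N₂ N₃} f g := ObjectProperty.hom_ext _ (by
    have h := (d N₂).comp_p_i hPQ (d N₁).left_prop ((d N₁).i ≫ f)
    simp only [Category.assoc] at h
    simp [reassoc_of% h])

variable {C : Type u} [Category.{v} C] [MonoidalCategory C] [MonoidalLeftAction C D]
  (hact : ∀ (X : C) (N : D), P N → P (X ⊙ₗ N))

/-- The projection to the full subcategory of first summands commutes with the action. -/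
@[reducible]
def laxLeftLinearProjection (hPQ : ∀ X Y, P X → Q Y → ∀ f : X ⟶ Y, f = 0)
    (hQP : ∀ X Y, Q X → P Y → ∀ f : X ⟶ Y, f = 0) :
    letI := fullSubcategoryAction P hact
    (projection d hPQ).LaxLeftLinear C :=
  letI := fullSubcategoryAction P hact
  { μₗ := fun X N => ObjectProperty.homMk (X ⊴ₗ (d N).i ≫ (d (X ⊙ₗ N)).p)
    μₗ_naturality_left := fun {X Y} f N => ObjectProperty.hom_ext _ (by
      have h := (d (X ⊙ₗ N)).p_i_comp hQP (d (Y ⊙ₗ N)).left_prop (f ⊵ₗ N ≫ (d (Y ⊙ₗ N)).p)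
      change f ⊵ₗ (d N).left ≫ Y ⊴ₗ (d N).i ≫ (d (Y ⊙ₗ N)).p =
        (X ⊴ₗ (d N).i ≫ (d (X ⊙ₗ N)).p) ≫ (d (X ⊙ₗ N)).i ≫ f ⊵ₗ N ≫ (d (Y ⊙ₗ N)).p
      rw [Category.assoc, h, action_exchange_assoc])
    μₗ_naturality_right := fun X {N N'} f => ObjectProperty.hom_ext _ (by
      have h := (d (X ⊙ₗ N)).p_i_comp hQP (d (X ⊙ₗ N')).left_prop (X ⊴ₗ f ≫ (d (X ⊙ₗ N')).p)
      have h' := (d N').comp_p_i hPQ (d N).left_prop ((d N).i ≫ f)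
      change X ⊴ₗ ((d N).i ≫ f ≫ (d N').p) ≫ X ⊴ₗ (d N').i ≫ (d (X ⊙ₗ N')).p =
        (X ⊴ₗ (d N).i ≫ (d (X ⊙ₗ N)).p) ≫ (d (X ⊙ₗ N)).i ≫ X ⊴ₗ f ≫ (d (X ⊙ₗ N')).p
      rw [Category.assoc, h, ← actionHomRight_comp_assoc, ← actionHomRight_comp_assoc,
        Category.assoc, Category.assoc, ← h', Category.assoc])
    μₗ_associativity := fun X Y N => ObjectProperty.hom_ext _ (by
      have h := (d ((X ⊗ Y) ⊙ₗ N)).p_i_comp hQP (d (X ⊙ₗ Y ⊙ₗ N)).left_prop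
        ((αₗ X Y N).hom ≫ (d (X ⊙ₗ Y ⊙ₗ N)).p)
      have h' := (d (Y ⊙ₗ N)).comp_p_i hPQ (hact Y _ (d N).left_prop) (Y ⊴ₗ (d N).i)
      change ((X ⊗ Y) ⊴ₗ (d N).i ≫ (d ((X ⊗ Y) ⊙ₗ N)).p) ≫ (d ((X ⊗ Y) ⊙ₗ N)).i ≫
        (αₗ X Y N).hom ≫ (d (X ⊙ₗ Y ⊙ₗ N)).p = (αₗ X Y (d N).left).hom ≫
        X ⊴ₗ (Y ⊴ₗ (d N).i ≫ (d (Y ⊙ₗ N)).p) ≫ X ⊴ₗ (d (Y ⊙ₗ N)).i ≫ (d (X ⊙ₗ Y ⊙ₗ N)).p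
      rw [Category.assoc, h, ← actionHomRight_comp_assoc, Category.assoc, h']
      simp)
    μₗ_unitality := fun N => ObjectProperty.hom_ext _ (by
      have h := (d (𝟙_ C ⊙ₗ N)).p_i_comp hQP (d N).left_prop ((λₗ N).hom ≫ (d N).p)
      change (λₗ (d N).left).hom = (𝟙_ C ⊴ₗ (d N).i ≫ (d (𝟙_ C ⊙ₗ N)).p) ≫
        (d (𝟙_ C ⊙ₗ N)).i ≫ (λₗ N).hom ≫ (d N).p
      rw [Category.assoc, h, ← actionUnitIso_hom_naturality_assoc, (d N).i_p, Category.comp_id]) }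

theorem isIso_projection_μₗ (hPQ : ∀ X Y, P X → Q Y → ∀ f : X ⟶ Y, f = 0)
    (hQP : ∀ X Y, Q X → P Y → ∀ f : X ⟶ Y, f = 0)
    (hactQ : ∀ (X : C) (N : D), Q N → Q (X ⊙ₗ N))
    (hadd : ∀ (X : C) {N P : D} (f g : N ⟶ P), X ⊴ₗ (f + g) = X ⊴ₗ f + X ⊴ₗ g) (X : C) (N : D) :
    letI := fullSubcategoryAction P hact
    letI := laxLeftLinearProjection d hact hPQ hQP
    IsIso (Functor.LaxLeftLinear.μₗ (projection d hPQ) X N) := by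
  let := fullSubcategoryAction P hact
  let := laxLeftLinearProjection d hact hPQ hQP
  refine ⟨ObjectProperty.homMk ((d (X ⊙ₗ N)).i ≫ X ⊴ₗ (d N).p), ObjectProperty.hom_ext _ ?_,
    ObjectProperty.hom_ext _ ?_⟩
  · have h := (d (X ⊙ₗ N)).comp_p_i hPQ (hact X _ (d N).left_prop) (X ⊴ₗ (d N).i)
    change (X ⊴ₗ (d N).i ≫ (d (X ⊙ₗ N)).p) ≫ (d (X ⊙ₗ N)).i ≫ X ⊴ₗ (d N).p = 𝟙 _
    rw [Category.assoc, reassoc_of% h, ← actionHomRight_comp,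
      (d N).i_p, actionHomRight_id]
  · change ((d (X ⊙ₗ N)).i ≫ X ⊴ₗ (d N).p) ≫ X ⊴ₗ (d N).i ≫ (d (X ⊙ₗ N)).p = 𝟙 _
    have h1 := congrArg (fun t => (d (X ⊙ₗ N)).i ≫ X ⊴ₗ t ≫ (d (X ⊙ₗ N)).p) (d N).total
    -- Stability of `Q` under the action kills the cross term left by `(d N).total`.
    have h2 := hPQ _ _ (d (X ⊙ₗ N)).left_prop (hactQ X _ (d N).right_prop)
      ((d (X ⊙ₗ N)).i ≫ X ⊴ₗ (d N).q)
    simp only [hadd, Preadditive.add_comp, Preadditive.comp_add, actionHomRight_comp,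
      Category.assoc, reassoc_of% h2, zero_comp, add_zero, actionHomRight_id,
      Category.id_comp, (d (X ⊙ₗ N)).i_p] at h1
    simpa only [Category.assoc] using h1

end Decomposition

end Decomposition

/-! ### Linear functors into a product -/

section Prod

variable {C : Type u} [Category.{v} C] [MonoidalCategory C]
  {D : Type u₁} [Category.{v₁} D] [MonoidalLeftAction C D]
  {E₁ : Type u₂} [Category.{v₂} E₁] [MonoidalLeftAction C E₁]
  {E₂ : Type u₂} [Category.{v₂} E₂] [MonoidalLeftAction C E₂]

open Functor.LaxLeftLinear in
/-- The pairing of lax linear functors is lax linear. -/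
instance (F₁ : D ⥤ E₁) (F₂ : D ⥤ E₂) [F₁.LaxLeftLinear C] [F₂.LaxLeftLinear C] :
    (F₁.prod' F₂).LaxLeftLinear C where
  μₗ X N := (μₗ F₁ X N, μₗ F₂ X N)
  μₗ_naturality_left f N :=
    Prod.ext (μₗ_naturality_left F₁ f N) (μₗ_naturality_left F₂ f N)
  μₗ_naturality_right X _ _ f :=
    Prod.ext (μₗ_naturality_right F₁ X f) (μₗ_naturality_right F₂ X f)
  μₗ_associativity X Y N :=
    Prod.ext (μₗ_associativity F₁ X Y N) (μₗ_associativity F₂ X Y N)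
  μₗ_unitality N := Prod.ext (μₗ_unitality F₁ N) (μₗ_unitality F₂ N)

open Functor.LaxLeftLinear in
theorem isIso_prod'_μₗ (F₁ : D ⥤ E₁) (F₂ : D ⥤ E₂) [F₁.LaxLeftLinear C] [F₂.LaxLeftLinear C]
    (X : C) (N : D) [IsIso (μₗ F₁ X N)] [IsIso (μₗ F₂ X N)] :
    IsIso (μₗ (F₁.prod' F₂) X N) :=
  ⟨(inv (μₗ F₁ X N), inv (μₗ F₂ X N)),
    Prod.ext (IsIso.hom_inv_id (μₗ F₁ X N)) (IsIso.hom_inv_id (μₗ F₂ X N)),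
    Prod.ext (IsIso.inv_hom_id (μₗ F₁ X N)) (IsIso.inv_hom_id (μₗ F₂ X N))⟩

end Prod

section Decomposition

variable {D : Type u₁} [Category.{v₁} D] [Preadditive D] [HasBinaryBiproducts D]
  {P Q : ObjectProperty D} (d : ∀ N, Decomposition P Q N)

namespace Decomposition

/-- Orthogonality in both directions makes every morphism block diagonal. The components of `X ⊞ Y`,
for `X` in `P` and `Y` in `Q`, are then `X` and `Y`. -/
theorem isEquivalence_prod'_projection (hPQ : ∀ X Y, P X → Q Y → ∀ f : X ⟶ Y, f = 0)
    (hQP : ∀ X Y, Q X → P Y → ∀ f : X ⟶ Y, f = 0) :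
    ((projection d hPQ).prod' (projection (fun N => (d N).swap) hQP)).IsEquivalence where
  faithful := ⟨fun {N N'} f g h => by
    have h1 : (d N).i ≫ f ≫ (d N').p = (d N).i ≫ g ≫ (d N').p :=
      congrArg (fun t => t.1.hom) h
    have h2 : (d N).j ≫ f ≫ (d N').q = (d N).j ≫ g ≫ (d N').q :=
      congrArg (fun t => t.2.hom) h
    have key (f : N ⟶ N') : f = (d N).p ≫ ((d N).i ≫ f ≫ (d N').p) ≫ (d N').i +
        (d N).q ≫ ((d N).j ≫ f ≫ (d N').q) ≫ (d N').j := by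
      have h3 := (d N').comp_p_i hPQ (d N).left_prop ((d N).i ≫ f)
      have h4 : ((d N).j ≫ f) ≫ (d N').q ≫ (d N').j = (d N).j ≫ f :=
        (d N').swap.comp_p_i hQP (d N).right_prop _
      simp only [Category.assoc] at h3 h4
      simp only [Category.assoc, h3, h4]
      rw [← Category.assoc, ← Category.assoc, ← Preadditive.add_comp, (d N).total,
        Category.id_comp]
    rw [key f, key g, h1, h2]⟩
  full := ⟨fun {N N'} φ => by
    let f₁ : (d N).left ⟶ (d N').left := φ.1.hom
    let f₂ : (d N).right ⟶ (d N').right := φ.2.hom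
    have h1 : (d N).i ≫ (d N).q = 0 := hPQ _ _ (d N).left_prop (d N).right_prop _
    have h2 : (d N).j ≫ (d N).p = 0 := hQP _ _ (d N).right_prop (d N).left_prop _
    refine ⟨(d N).p ≫ f₁ ≫ (d N').i + (d N).q ≫ f₂ ≫ (d N').j,
      Prod.ext (ObjectProperty.hom_ext _ ?_) (ObjectProperty.hom_ext _ ?_)⟩
    · change (d N).i ≫ ((d N).p ≫ f₁ ≫ (d N').i + (d N).q ≫ f₂ ≫ (d N').j) ≫ (d N').p = f₁
      simp only [Preadditive.add_comp, Preadditive.comp_add, Category.assoc, reassoc_of% h1,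
        zero_comp, add_zero, (d N').i_p, reassoc_of% (d N).i_p, Category.comp_id]
    · change (d N).j ≫ ((d N).p ≫ f₁ ≫ (d N').i + (d N).q ≫ f₂ ≫ (d N').j) ≫ (d N').q = f₂
      simp only [Preadditive.add_comp, Preadditive.comp_add, Category.assoc, reassoc_of% h2,
        zero_comp, zero_add, (d N').j_q, reassoc_of% (d N).j_q, Category.comp_id]⟩
  essSurj := ⟨fun ⟨X, Y⟩ => by
    let N := X.obj ⊞ Y.obj
    have h1 := (d N).comp_p_i hPQ X.property biprod.inl
    have h2 : biprod.inr ≫ (d N).q ≫ (d N).j = biprod.inr :=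
      (d N).swap.comp_p_i hQP Y.property _
    have h3 : (d N).i ≫ biprod.fst ≫ biprod.inl = (d N).i := by
      have h := congrArg (fun t => (d N).i ≫ t) (biprod.total (X := X.obj) (Y := Y.obj))
      have h0 := hPQ _ _ (d N).left_prop Y.property ((d N).i ≫ biprod.snd)
      simp only [Preadditive.comp_add, reassoc_of% h0, zero_comp, add_zero] at h
      exact h.trans (Category.comp_id _)
    have h4 : (d N).j ≫ biprod.snd ≫ biprod.inr = (d N).j := by
      have h := congrArg (fun t => (d N).j ≫ t) (biprod.total (X := X.obj) (Y := Y.obj))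
      have h0 := hQP _ _ (d N).right_prop X.property ((d N).j ≫ biprod.fst)
      simp only [Preadditive.comp_add, reassoc_of% h0, zero_comp, zero_add] at h
      exact h.trans (Category.comp_id _)
    refine ⟨N, ⟨Iso.prod (P.isoMk ⟨(d N).i ≫ biprod.fst, biprod.inl ≫ (d N).p, ?_, ?_⟩)
      (Q.isoMk ⟨(d N).j ≫ biprod.snd, biprod.inr ≫ (d N).q, ?_, ?_⟩)⟩⟩
    · change ((d N).i ≫ biprod.fst) ≫ biprod.inl ≫ (d N).p = 𝟙 _
      rw [Category.assoc, reassoc_of% h3, (d N).i_p]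
    · change (biprod.inl ≫ (d N).p) ≫ (d N).i ≫ biprod.fst = 𝟙 _
      rw [Category.assoc, reassoc_of% h1, biprod.inl_fst]
    · change ((d N).j ≫ biprod.snd) ≫ biprod.inr ≫ (d N).q = 𝟙 _
      rw [Category.assoc, reassoc_of% h4, (d N).j_q]
    · change (biprod.inr ≫ (d N).q) ≫ (d N).j ≫ biprod.snd = 𝟙 _
      rw [Category.assoc, reassoc_of% h2, biprod.inr_snd]⟩

theorem moduleEquivalent_prod (d : ∀ N, Decomposition P Q N)
    (hPQ : ∀ X Y, P X → Q Y → ∀ f : X ⟶ Y, f = 0)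
    (hQP : ∀ X Y, Q X → P Y → ∀ f : X ⟶ Y, f = 0)
    {C : Type u} [Category.{v} C] [MonoidalCategory C] [MonoidalLeftAction C D]
    (hactP : ∀ (X : C) (N : D), P N → P (X ⊙ₗ N)) (hactQ : ∀ (X : C) (N : D), Q N → Q (X ⊙ₗ N))
    (hadd : ∀ (X : C) {N P : D} (f g : N ⟶ P), X ⊴ₗ (f + g) = X ⊴ₗ f + X ⊴ₗ g) :
    letI := fullSubcategoryAction P hactP
    letI := fullSubcategoryAction Q hactQ
    ModuleEquivalent C D (P.FullSubcategory × Q.FullSubcategory) := by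
  let := fullSubcategoryAction P hactP
  let := fullSubcategoryAction Q hactQ
  let := laxLeftLinearProjection d hactP hPQ hQP
  let := laxLeftLinearProjection (fun N => (d N).swap) hactQ hQP hPQ
  have (X : C) (N : D) := isIso_projection_μₗ d hactP hPQ hQP hactQ hadd X N
  have (X : C) (N : D) :=
    isIso_projection_μₗ (fun N => (d N).swap) hactQ hQP hPQ hactP hadd X N
  have (X : C) (N : D) := isIso_prod'_μₗ (projection d hPQ)
    (projection (fun N => (d N).swap) hQP) X N
  exact ⟨_, isEquivalence_prod'_projection d hPQ hQP, ⟨leftLinearOfIsIso _⟩⟩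

end Decomposition

end Decomposition

/-! ## Generators of indecomposable semisimple module categories -/

section Orthogonal

variable (C : Type u) [Category.{v} C] [MonoidalCategory C]
  {D : Type u₁} [Category.{v₁} D] [Preadditive D] [MonoidalLeftAction C D]

/-- The objects that receive no nonzero morphisms from the objects `X ⊙ₗ M`. -/
def rightOrthogonal (M : D) : ObjectProperty D := fun Z => ∀ (X : C) (f : X ⊙ₗ M ⟶ Z), f = 0

/-- The objects without nonzero morphisms to the objects of `Q`. -/
def leftOrthogonal (Q : ObjectProperty D) : ObjectProperty D :=
  fun N => ∀ Z, Q Z → ∀ f : N ⟶ Z, f = 0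

variable {C}

theorem rightOrthogonal_of_retract {M X Y : D} (r : Retract X Y)
    (hY : rightOrthogonal C M Y) : rightOrthogonal C M X := fun Z f => by
  rw [← Category.comp_id f, ← r.retract, ← Category.assoc, hY Z (f ≫ r.i), zero_comp]

theorem leftOrthogonal_of_retract {Q : ObjectProperty D} {X Y : D} (r : Retract X Y)
    (hY : leftOrthogonal Q Y) : leftOrthogonal Q X := fun Z hZ f => by
  rw [← Category.id_comp f, ← r.retract, Category.assoc, hY Z hZ (r.r ≫ f), comp_zero]

theorem rightOrthogonal_biprod [HasBinaryBiproducts D] {M : D} (X Y : D)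
    (hX : rightOrthogonal C M X) (hY : rightOrthogonal C M Y) :
    rightOrthogonal C M (X ⊞ Y) := fun Z f => by
  apply biprod.hom_ext
  · rw [hX Z (f ≫ biprod.fst), zero_comp]
  · rw [hY Z (f ≫ biprod.snd), zero_comp]

theorem leftOrthogonal_biprod [HasBinaryBiproducts D] {Q : ObjectProperty D} (X Y : D)
    (hX : leftOrthogonal Q X) (hY : leftOrthogonal Q Y) :
    leftOrthogonal Q (X ⊞ Y) := fun Z hZ f => by
  apply biprod.hom_ext'
  · rw [hX Z hZ (biprod.inl ≫ f), comp_zero]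
  · rw [hY Z hZ (biprod.inr ≫ f), comp_zero]

/-- `Hom(X ⊙ M, Y ⊙ Z) ≃ Hom(Yᵛ ⊙ X ⊙ M, Z)`. The left orthogonal case uses the left dual in the
same way. -/
theorem rightOrthogonal_action [∀ X : C, HasRightDual X] {M : D} (Y : C) (Z : D)
    (hZ : rightOrthogonal C M Z) : rightOrthogonal C M (Y ⊙ₗ Z) := fun X f => by
  have h (g : HasRightDual.rightDual Y ⊙ₗ X ⊙ₗ M ⟶ Z) : g = 0 := by
    rw [← cancel_epi (αₗ (HasRightDual.rightDual Y) X M).hom, comp_zero]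
    exact hZ _ _
  apply (actionHomEquiv Y (HasRightDual.rightDual Y) (X ⊙ₗ M) Z).symm.injective
  exact (h _).trans (h _).symm

theorem leftOrthogonal_action [∀ X : C, HasLeftDual X] {Q : ObjectProperty D}
    (hQ : ∀ (X : C) (N : D), Q N → Q (X ⊙ₗ N)) (Y : C) (N : D)
    (hN : leftOrthogonal Q N) : leftOrthogonal Q (Y ⊙ₗ N) := fun Z hZ f => by
  have h (g : N ⟶ HasLeftDual.leftDual Y ⊙ₗ Z) : g = 0 := hN _ (hQ _ _ hZ) g
  apply (actionHomEquiv (HasLeftDual.leftDual Y) Y N Z).injective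
  exact (h _).trans (h _).symm

theorem leftOrthogonal_rightOrthogonal_self (M : D) :
    leftOrthogonal (rightOrthogonal C M) M := fun Z hZ f => by
  rw [← cancel_epi (λₗ[C] M).hom, comp_zero]
  exact hZ _ _

/-- If `f : X ⊙ₗ M ⟶ S` is nonzero with pseudo-inverse `s`, then `s ≫ f` is a nonzero endomorphism
of a simple object, hence invertible. -/
theorem rightOrthogonal_or_retract (hreg : ∀ {X Y : D} (f : X ⟶ Y), IsRegularHom f)
    (M S : D) [Simple S] [HasKernels D] :
    rightOrthogonal C M S ∨ ∃ X : C, Nonempty (Retract S (X ⊙ₗ M)) := by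
  refine or_iff_not_imp_left.2 fun h => ?_
  simp only [rightOrthogonal, not_forall] at h
  obtain ⟨X, f, hf⟩ := h
  obtain ⟨s, hs⟩ := hreg f
  have h1 : s ≫ f ≠ 0 := fun h0 => hf (by rw [← hs, h0, comp_zero])
  have := isIso_of_hom_simple h1
  exact ⟨X, ⟨{ i := inv (s ≫ f) ≫ s, r := f, retract := by simp }⟩⟩

theorem leftOrthogonal_of_retract_action {M N : D} {X : C} (r : Retract N (X ⊙ₗ M)) :
    leftOrthogonal (rightOrthogonal C M) N :=
  leftOrthogonal_of_retract r fun _ hZ f => hZ X f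

/-- In a semisimple category, every object is the direct sum of an object of `P` and an object of
`Q` if every simple object is in one of these orthogonal classes. -/
theorem nonempty_decomposition [IsIdempotentComplete D] (hss : IsSemisimpleCategory D) (M : D)
    (h : ∀ S : D, Simple S →
      rightOrthogonal C M S ∨ leftOrthogonal (rightOrthogonal C M) S) (N : D) :
    Nonempty (Decomposition (leftOrthogonal (rightOrthogonal C M)) (rightOrthogonal C M) N) := by
  classical
  obtain ⟨n, S, b, hS, ⟨hb⟩, ⟨t⟩⟩ := hss N
  -- `e` projects onto the simple summands outside `rightOrthogonal C M`; the two parts are the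
  -- images of `e` and `𝟙 - e`.
  let e : b.pt ⟶ b.pt := hb.isColimit.desc
    (Cofan.mk b.pt fun l => if rightOrthogonal C M (S l) then 0 else b.ι l)
  have he (l : Fin n) : b.ι l ≫ e = if rightOrthogonal C M (S l) then 0 else b.ι l :=
    hb.isColimit.fac _ ⟨l⟩
  have he' (l : Fin n) : e ≫ b.π l = if rightOrthogonal C M (S l) then 0 else b.π l := by
    apply hb.isColimit.hom_ext
    rintro ⟨m⟩
    change b.ι m ≫ e ≫ b.π l = b.ι m ≫ _
    rw [← Category.assoc, he]
    by_cases hml : m = l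
    · subst hml
      split_ifs <;> simp
    · have := bicone_ι_π_ne b hml
      split_ifs <;> simp [this]
  have hee : e ≫ e = e := by
    apply hb.isColimit.hom_ext
    rintro ⟨m⟩
    change b.ι m ≫ e ≫ e = b.ι m ≫ e
    rw [← Category.assoc, he]
    split_ifs with hm
    · simp
    · simp [he, hm]
  obtain ⟨N₁, i, p, hip, hpi⟩ := IsIdempotentComplete.idempotents_split _ e hee
  obtain ⟨N₂, j, q, hjq, hqj⟩ := IsIdempotentComplete.idempotents_split _ (𝟙 b.pt - e)
    (Idempotents.idem_of_id_sub_idem _ hee)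
  refine ⟨{ left := N₁, right := N₂, left_prop := fun Z hZ f => ?_, right_prop := fun X f => ?_,
            i := i ≫ t.inv, p := t.hom ≫ p, j := j ≫ t.inv, q := t.hom ≫ q,
            i_p := by simp [hip], j_q := by simp [hjq], total := ?_ }⟩
  · have h0 : p ≫ f = 0 := by
      apply hb.isColimit.hom_ext
      rintro ⟨l⟩
      change b.ι l ≫ p ≫ f = b.ι l ≫ 0
      have h1 : p = e ≫ p := by rw [← hpi, Category.assoc, hip, Category.comp_id]
      rw [comp_zero]
      by_cases hl : rightOrthogonal C M (S l)
      · rw [h1, Category.assoc, ← Category.assoc, he, if_pos hl, zero_comp]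
      · exact ((h _ (hS l)).resolve_left hl) Z hZ _
    rw [← Category.id_comp f, ← hip, Category.assoc, h0, comp_zero]
  · have h0 : f ≫ j = 0 := by
      apply hb.isLimit.hom_ext
      rintro ⟨l⟩
      change (f ≫ j) ≫ b.π l = 0 ≫ b.π l
      have h1 : j = j ≫ (𝟙 _ - e) := by rw [← hqj, reassoc_of% hjq]
      rw [zero_comp]
      by_cases hl : rightOrthogonal C M (S l)
      · exact hl X _
      · rw [h1]
        simp [he', hl]
    rw [← Category.comp_id f, ← hjq, ← Category.assoc, h0, zero_comp]
  · have : t.hom ≫ (p ≫ i + q ≫ j) ≫ t.inv = 𝟙 N := by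
      rw [hpi, hqj]
      simp
    simpa using this

/-- A finite direct sum of retracts of objects `X ⊙ₗ M` is such a retract. -/
theorem exists_retract_of_isBilimit [HasZeroMorphisms C] [HasFiniteBiproducts C] {M : D} {n : ℕ}
    {S : Fin n → D} (hzero : ∀ X Y : C, (0 : X ⟶ Y) ⊵ₗ M = 0) (b : Bicone S) (hb : b.IsBilimit)
    (h : ∀ l, ∃ X : C, Nonempty (Retract (S l) (X ⊙ₗ M))) :
    ∃ X : C, Nonempty (Retract b.pt (X ⊙ₗ M)) := by
  choose X r using h
  let i : b.pt ⟶ (⨁ X) ⊙ₗ M :=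
    hb.isColimit.desc (Cofan.mk _ fun l => (r l).some.i ≫ biproduct.ι X l ⊵ₗ M)
  let p : (⨁ X) ⊙ₗ M ⟶ b.pt :=
    hb.isLimit.lift (Fan.mk _ fun l => biproduct.π X l ⊵ₗ M ≫ (r l).some.r)
  have hi (l : Fin n) : b.ι l ≫ i = (r l).some.i ≫ biproduct.ι X l ⊵ₗ M :=
    hb.isColimit.fac _ ⟨l⟩
  have hp (l : Fin n) : p ≫ b.π l = biproduct.π X l ⊵ₗ M ≫ (r l).some.r :=
    hb.isLimit.fac _ ⟨l⟩
  refine ⟨⨁ X, ⟨{ i := i, r := p, retract := hb.isColimit.hom_ext ?_ }⟩⟩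
  rintro ⟨l⟩
  apply hb.isLimit.hom_ext
  rintro ⟨m⟩
  change (b.ι l ≫ i ≫ p) ≫ b.π m = (b.ι l ≫ 𝟙 _) ≫ b.π m
  rw [Category.assoc, Category.assoc, hp, reassoc_of% hi, ← comp_actionHomLeft_assoc,
    Category.comp_id]
  by_cases hlm : l = m
  · subst hlm
    simp
  · simp [biproduct.ι_π_ne X hlm, bicone_ι_π_ne b hlm, hzero]

end Orthogonal

section Generator

variable {k : Type w} [Field k] {C : Type u} [Category.{v} C] [Abelian C] [Linear k C]
  [MonoidalCategory C] [RigidCategory C] {D : Type u₁} [Category.{v₁} D] [Preadditive D]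
  [Linear k D] [MonoidalLeftAction C D] [IsIdempotentComplete D] [HasZeroObject D]
  [HasBinaryBiproducts D] [HasKernels D]

/-- In an indecomposable semisimple module category, every object is a retract of an object
`X ⊙ₗ M`, for any given nonzero `M`. -/
theorem exists_retract_action (h : IsBilinearAction k C D) (hC : IsSemisimpleCategory C)
    (hD : IsSemisimpleCategory D) (hind : IsIndecomposable k C D) (M : D) (hM : ¬ IsZero M)
    (N : D) : ∃ X : C, Nonempty (Retract N (X ⊙ₗ M)) := by
  have hor (S : D) (_ : Simple S) := rightOrthogonal_or_retract (C := C)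
    (isRegularHom_of_semisimple hD) M S
  -- Indecomposability enters here: a nonzero `Z` would split the category into two nonzero
  -- summands, one containing `M` and the other `Z`.
  have hzero (Z : D) (hZ : rightOrthogonal C M Z) : IsZero Z := by
    by_contra hZ0
    apply hind
    refine ⟨fullModuleSubcategory h (isRegularHom_of_semisimple hC) (isRegularHom_of_semisimple hD)
        (leftOrthogonal (rightOrthogonal C M)) leftOrthogonal_of_retract
        (fun X hX _ _ f => hX.eq_of_src f 0) leftOrthogonal_biprod
        (leftOrthogonal_action rightOrthogonal_action),
      fullModuleSubcategory h (isRegularHom_of_semisimple hC) (isRegularHom_of_semisimple hD)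
        (rightOrthogonal C M) rightOrthogonal_of_retract
        (fun X hX _ f => hX.eq_of_tgt f 0) rightOrthogonal_biprod rightOrthogonal_action,
      ⟨⟨M, leftOrthogonal_rightOrthogonal_self M⟩, fun h0 => hM ?_⟩,
      ⟨⟨Z, hZ⟩, fun h0 => hZ0 ?_⟩, ?_⟩
    · exact ((leftOrthogonal (rightOrthogonal C M)).ι).map_isZero h0
    · exact ((rightOrthogonal C M).ι).map_isZero h0
    · have d (N : D) := (nonempty_decomposition (C := C) hD M (fun S hS =>
        (hor S hS).imp_right fun ⟨_, ⟨r⟩⟩ => leftOrthogonal_of_retract_action r) N).some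
      refine Decomposition.moduleEquivalent_prod d (fun _ _ hX hY f => hX _ hY f) ?_
        (leftOrthogonal_action rightOrthogonal_action) rightOrthogonal_action h.action_add
      -- A pseudo-inverse of `f` runs in the direction already known to vanish, so `f = f ≫ s ≫ f =
      -- 0`.
      intro X Y hX hY f
      obtain ⟨s, hs⟩ := isRegularHom_of_semisimple hD f
      rw [← hs, hY X hX s, zero_comp, comp_zero]
  obtain ⟨n, S, b, hS, ⟨hb⟩, ⟨t⟩⟩ := hD N
  have : HasFiniteBiproducts C := Abelian.hasFiniteBiproducts
  obtain ⟨X, ⟨r⟩⟩ := exists_retract_of_isBilimit (C := C) (M := M)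
    (fun X Y => by simpa using h.smul_action (0 : k) (0 : X ⟶ Y) M) b hb
    fun l => (hor _ (hS l)).resolve_left fun h0 =>
      have := hS l
      Simple.not_isZero _ (hzero _ h0)
  exact ⟨X, ⟨(Retract.ofIso t).trans r⟩⟩

end Generator

/-! ## The main theorem -/

namespace RightMod

variable {k : Type w} [Field k] {C : Type u} [Category.{v} C] [Abelian C] [Linear k C]
  [MonoidalCategory C] [MonoidalPreadditive C] [MonoidalLinear k C] {A : C} [MonObj A]

theorem isBilinearAction : IsBilinearAction k C (RightMod A) where
  action_add _ _ _ f g := hom_ext (MonoidalPreadditive.whiskerLeft_add f.hom g.hom)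
  action_smul X _ _ c f := hom_ext (MonoidalLinear.whiskerLeft_smul X c f.hom)
  add_action f g _ := hom_ext (MonoidalPreadditive.add_whiskerRight f g)
  smul_action c f N := hom_ext (MonoidalLinear.smul_whiskerRight c f N.X)

/-- The regular module is nonzero, so its decomposition has at least one simple summand. -/
theorem exists_simple (hA : ¬ IsZero A) (hss : IsSemisimpleCategory (RightMod A)) :
    ∃ M : RightMod A, Simple M := by
  obtain ⟨n, S, b, hS, ⟨hb⟩, ⟨t⟩⟩ := hss (regular A)
  obtain - | n := n
  · exfalso
    apply hA
    have h0 : 𝟙 (regular A) = 0 := by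
      rw [← cancel_epi t.inv]
      apply hb.isColimit.hom_ext
      rintro ⟨l⟩
      exact l.elim0
    rw [IsZero.iff_id_eq_zero]
    exact congrArg Hom.hom h0
  · exact ⟨S 0, hS 0⟩

end RightMod

/-- `Hom(1, B) ≃ Hom(1 ⊙ M, M) ≃ End(M)` takes the unit to the identity, and `End(M) = k` by Schur's
lemma over an algebraically closed field. -/
theorem InternalHoms.bijective_smul_unit {k : Type w} [Field k] [IsAlgClosed k]
    {C : Type u} [Category.{v} C] [Preadditive C] [Linear k C] [MonoidalCategory C]
    {D : Type u₁} [Category.{v₁} D] [Preadditive D] [Linear k D] [HasKernels D]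
    [MonoidalLeftAction C D] (h : IsBilinearAction k C D) {M : D} (I : InternalHoms C M)
    [Simple M] [FiniteDimensional k (M ⟶ M)] :
    Function.Bijective (fun c : k => (c • η[I.obj M] : 𝟙_ C ⟶ I.obj M)) := by
  have key (c : k) : (c • η[I.obj M]) ⊵ₗ M ≫ I.ev M = (λₗ M).hom ≫ (c • 𝟙 M) := by
    rw [h.smul_action, Linear.smul_comp]
    erw [I.unit_ev]
    simp
  constructor
  · intro c d hcd
    have h1 : (λₗ[C] M).hom ≫ (c • 𝟙 M) = (λₗ[C] M).hom ≫ (d • 𝟙 M) := by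
      rw [← key, ← key]
      exact congrArg (fun t => t ⊵ₗ M ≫ I.ev M) hcd
    rw [cancel_epi] at h1
    exact smul_left_injective k (id_nonzero M) h1
  · intro f
    obtain ⟨c, hc⟩ := endomorphism_simple_eq_smul_id k ((λₗ[C] M).inv ≫ f ⊵ₗ M ≫ I.ev M)
    refine ⟨c, I.hom_ext ?_⟩
    rw [key, hc, Iso.hom_inv_id_assoc]

end TensorMorita

theorem mainTheorem12 (k : Type w) [Field k] [IsAlgClosed k]
    (C : Type u) [Category.{v} C] [Abelian C] [Linear k C]
    [MonoidalCategory C] [MonoidalPreadditive C] [MonoidalLinear k C] [RigidCategory C]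
    (hfin : ∀ X Y : C, FiniteDimensional k (X ⟶ Y))
    (hss : TensorMorita.IsSemisimpleCategory C)
    (hsimples : TensorMorita.HasFinitelyManySimples C)
    (hunit : Simple (𝟙_ C))
    (A : C) [MonObj A] (hA : ¬ IsZero A)
    (hAss : TensorMorita.IsSemisimpleAlgebra A)
    (hAind : TensorMorita.IsIndecomposableAlgebra k A) :
    (∃ M : TensorMorita.RightMod A, Simple M) ∧
    ∀ M : TensorMorita.RightMod A, Simple M →
      ∃ (B : C) (_ : MonObj B),
        TensorMorita.IsInternalEnd M B ∧
        TensorMorita.MoritaEquivalent A B ∧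
        Function.Bijective (fun c : k => (c • η[B] : 𝟙_ C ⟶ B)) := by
  refine ⟨TensorMorita.RightMod.exists_simple hA hAss, fun M hM => ?_⟩
  let I := TensorMorita.RightMod.internalHoms M
  have hgen := TensorMorita.exists_retract_action
    (TensorMorita.RightMod.isBilinearAction (k := k)) hss hAss hAind M (Simple.not_isZero M)
  have := hfin M.X M.X
  have : FiniteDimensional k (M ⟶ M) := TensorMorita.RightMod.finiteDimensional_hom M M
  exact ⟨I.obj M, inferInstance, I.isInternalEnd,
    ⟨I.functor, I.isEquivalence_functor hgen (TensorMorita.isRegularHom_of_semisimple hAss),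
      ⟨TensorMorita.leftLinearOfIsIso _⟩⟩,
    I.bijective_smul_unit TensorMorita.RightMod.isBilinearAction⟩
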